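/- **Theorem (Transport duality).** Let $\Omega$ be either a compact convex subset of $\mathbb R^d$ with non-empty interior, or the flat torus $\mathbb T^d=\mathbb R^d/\mathbb Z^d$ (functions on the torus are identified with their $\mathbb Z^d$-periodic lifts to $\mathbb R^d$, and $\int_\Omega$ is then the integral over the unit cube). Let $\mathcal P(\Omega)$ be the set of probability densities $p\in C^\infty(\Omega)$, $p\ge 0$, $\int_\Omega p\,dx=1$, and let $\mathcal F\colon\mathcal P(\Omega)\to\mathbb R$ be a functional and $q\in\mathcal P(\Omega)$ a reference density. *Transport coordinates.* A transport coordinate is a smooth function $\Phi$ with positive definite Hessian whose gradient $\nabla\Phi$ maps $\Omega$ bijectively onto $\Omega$; for the torus, $\Phi$ is a smooth function on $\mathbb R^d$ such that $\Phi-\tfrac12\|\cdot\|^2$ is periodic, and $\nabla\Phi$ is a bijection of $\mathbb R^d$. The density $p=\nabla\Phi_\#q$ is given by $p(\nabla\Phi(x))\det\nabla^2\Phi(x)=q(x)$. Put $\Phi_q(x)=\tfrac12\|x\|^2$, so that $\nabla\Phi_q=\mathrm{id}$. Let $K$ be a set of transport coordinates which is invariant under adding constants (for example, all of them), and set $$\tilde{\mathcal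 F}(\Phi)=\mathcal F(\nabla\Phi_\#q),\qquad \Phi\in K .$$ Assume that $\tilde{\mathcal F}$ is a convex functional on $K$ (in particular, that $K$ is convex). *First variations.* For a functional $G$ on a set $\mathcal D$ of functions and $f\in\mathcal D$, a function $g$ is called an $L^2$ first variation of $G$ at $f$, $g=\frac{\delta}{\delta f}G(f)$, if $\frac{d}{dt}G(c_t)\big|_{t=0^+}=\int_\Omega g\,\partial_tc_t|_{t=0^+}\,dx$ for every curve $(c_t)_{0\le t\le1}$ in $\mathcal D$ with $c_0=f$ which is smooth in $(t,x)$. This is applied to $\mathcal F$ on $\mathcal P(\Omega)$, to $\tilde{\mathcal F}$ on $K$, and to the conjugate $$\tilde{\mathcal F}^*(\Phi^*)=\sup_{\Phi\in K}\ \int_\Omega\Phi\,\Phi^*\,dx-\tilde{\mathcal F}(\Phi)$$ on the set $\mathcal M=\{\Phi^*\in C^\infty(\Omega)\colon\int_\Omega\Phi^*dx=0\}$, on which the pairing with $\Phi$ modulo constants is well defined. The first variations of $\mathcal F$ and $\tilde{\mathcal F}$ are taken in $C^\infty(\Omega)$. Those of $\tilde{\mathcal F}^*$ are smooth functions $\Psi$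 which, in the torus case, are such that $\Psi-\tfrac12\|\cdot\|^2$ is periodic. If $\tilde{\mathcal F}$ has a first variation $\Phi^*\in C^\infty(\Omega)$ at some $\Phi\in K$, then $\Phi^*\in\mathcal M$ and $\tilde{\mathcal F}^*$ is finite on $\mathcal M$. Moreover, the following hold whenever the first variations that occur in them exist. (i) For $\Phi\in K$, $$\nabla_x\frac{\delta}{\delta\Phi^*(x)}\tilde{\mathcal F}^*\Big(\frac{\delta}{\delta\Phi}\tilde{\mathcal F}(\Phi)\Big)=\nabla_x\Phi(x),\qquad x\in\Omega .$$ (ii) Let $\Phi_q\in K$, and let $p\in\mathcal P(\Omega)$ with $p=(\nabla\Phi_p)_\#q$, $\Phi_p\in K$. Then $$\mathrm D_{\mathrm T,\mathcal F}(p\|q)=\mathrm D_{\tilde{\mathcal F}}(\Phi_p\|\Phi_q),$$ where $$\mathrm D_{\mathrm T,\mathcal F}(p\|q)=\mathcal F(p)-\mathcal F(q)-\int_\Omega\Big(\nabla_x\frac{\delta}{\delta q(x)}\mathcal F(q),\nabla\Phi_p(x)-\nabla\Phi_q(x)\Big)q(x)\,dx,$$ $$\mathrm D_{\tilde{\mathcal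 F}}(\Phi_p\|\Phi_q)=\tilde{\mathcal F}(\Phi_p)-\tilde{\mathcal F}(\Phi_q)-\int_\Omega(\Phi_p-\Phi_q)\,\frac{\delta}{\delta\Phi_q}\tilde{\mathcal F}(\Phi_q)\,dx .$$ (iii) In the situation of (ii), with $\Phi_p^*=\frac{\delta}{\delta\Phi_p}\tilde{\mathcal F}(\Phi_p)$ and $\Phi_q^*=\frac{\delta}{\delta\Phi_q}\tilde{\mathcal F}(\Phi_q)$, $$\mathrm D_{\tilde{\mathcal F}}(\Phi_p\|\Phi_q)=\mathrm D_{\tilde{\mathcal F}^*}(\Phi_q^*\|\Phi_p^*)=\mathrm D_{\mathrm T,\mathcal F}(p\|q),$$ where $$\mathrm D_{\tilde{\mathcal F}^*}(\Phi_q^*\|\Phi_p^*)=\tilde{\mathcal F}^*(\Phi_q^*)-\tilde{\mathcal F}^*(\Phi_p^*)-\int_\Omega(\Phi_q^*-\Phi_p^*)\,\frac{\delta}{\delta\Phi_p^*}\tilde{\mathcal F}^*(\Phi_p^*)\,dx .$$ -/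

import Mathlib

open Set MeasureTheory
open scoped ContDiff

noncomputable section

/-- The ambient Euclidean space `ℝ^d`. -/
abbrev E (d : ℕ) : Type := EuclideanSpace ℝ (Fin d)

/-- The sample spaces: a `d`-dimensional compact convex set in `ℝ^d`, or the flat torus
`𝕋^d = ℝ^d / ℤ^d`. Objects on the torus are described by their lifts to `ℝ^d`. -/
inductive SampleSpace (d : ℕ) : Type
  | body (Ω : Set (E d)) (isCompact : IsCompact Ω) (convex : Convex ℝ Ω)
      (nonempty_interior : (interior Ω).Nonempty) : SampleSpace d
  | torus : SampleSpace d

namespace SampleSpace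

variable {d : ℕ}

/-- The set on which (lifted) functions live: `Ω` itself, or all of `ℝ^d` for the torus. -/
def carrier : SampleSpace d → Set (E d)
  | body Ω _ _ _ => Ω
  | torus => univ

/-- The set over which one integrates: `Ω` itself, or the unit cube for the torus. -/
def cell : SampleSpace d → Set (E d)
  | body Ω _ _ _ => Ω
  | torus => {x | ∀ i, x i ∈ Ico (0 : ℝ) 1}

/-- The group of periods: trivial for a convex set, `ℤ^d` for the torus. -/
def periods : SampleSpace d → Set (E d)
  | body _ _ _ _ => {0}
  | torus => {v | ∀ i, ∃ n : ℤ, v i = n}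

/-- `C^∞(Ω)`: functions smooth up to the boundary on a convex set; periodic smooth functions for
the torus. -/
def smooth (S : SampleSpace d) : Set (E d → ℝ) :=
  {f | ContDiffOn ℝ ∞ f S.carrier ∧ ∀ v ∈ S.periods, ∀ x, f (x + v) = f x}

/-- `∫_Ω f(x) dx`. -/
def integral (S : SampleSpace d) (f : E d → ℝ) : ℝ := ∫ x in S.cell, f x

/-- `∇f` on `Ω` (one-sided at boundary points of a convex set). -/
def grad (S : SampleSpace d) (f : E d → ℝ) (x : E d) : E d := gradientWithin f S.carrier x

/-- The Hessian `∇²f(x)`, i.e. the Jacobian operator of `∇f`. -/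
def hess (S : SampleSpace d) (f : E d → ℝ) (x : E d) : E d →L[ℝ] E d :=
  fderivWithin ℝ (S.grad f) S.carrier x

/-- `𝒫(Ω)`: smooth probability densities (extended by `0` outside a convex set, so that a density
on `Ω` is represented by exactly one function). -/
def densities (S : SampleSpace d) : Set (E d → ℝ) :=
  {p | p ∈ S.smooth ∧ (∀ x, 0 ≤ p x) ∧ (∀ x, x ∉ S.carrier → p x = 0) ∧ S.integral p = 1}

/-- `Φ_q(x) = ‖x‖² / 2`, the transport coordinate of the reference density. -/
def quad (x : E d) : ℝ := ‖x‖ ^ 2 / 2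

/-- The smooth potentials. On a convex set these are all smooth functions; on the torus these are
the smooth functions `Φ` on `ℝ^d` such that `Φ - ‖·‖²/2` is periodic, which says that the map `∇Φ`
is the identity plus a periodic gradient field and so descends to the torus. -/
def potentials (S : SampleSpace d) : Set (E d → ℝ) :=
  match S with
  | body Ω _ _ _ => {Φ | ContDiffOn ℝ ∞ Φ Ω}
  | torus => {Φ | (fun x => Φ x - quad x) ∈ (torus : SampleSpace d).smooth}

/-- The transport coordinates: smooth strictly convex potentials (with positive definite Hessian)
whose gradient map is a diffeomorphism of `Ω` onto itself. -/
def coords (S : SampleSpace d) : Set (E d → ℝ) :=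
  {Φ | Φ ∈ S.potentials ∧
    (∀ x ∈ S.carrier, ∀ v : E d, v ≠ 0 → 0 < inner ℝ (S.hess Φ x v) v) ∧
    BijOn (S.grad Φ) S.carrier S.carrier}

/-- `p = (∇Φ)_# q` for densities: `p(∇Φ(x)) det(∇²Φ(x)) = q(x)`. -/
def IsPush (S : SampleSpace d) (Φ q p : E d → ℝ) : Prop :=
  ∀ x ∈ S.carrier, p (S.grad Φ x) * (S.hess Φ x).det = q x

open Classical in
/-- The density `(∇Φ)_# q`, i.e. `y ↦ q(x) / det(∇²Φ(x))` with `x = (∇Φ)⁻¹(y)`. -/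
def push (S : SampleSpace d) (Φ q : E d → ℝ) (y : E d) : ℝ :=
  if y ∈ S.carrier then
    q (Function.invFunOn (S.grad Φ) S.carrier y) /
      (S.hess Φ (Function.invFunOn (S.grad Φ) S.carrier y)).det
  else 0

/-- `push` is the pushforward density. -/
theorem isPush_push (S : SampleSpace d) {Φ : E d → ℝ} (hΦ : Φ ∈ S.coords) (q : E d → ℝ) :
    S.IsPush Φ q (S.push Φ q) := by
  obtain ⟨-, hpos, hbij⟩ := hΦ
  intro x hx
  have hdet : (S.hess Φ x).det ≠ 0 := by
    intro h0
    have : LinearMap.det ((S.hess Φ x) : E d →ₗ[ℝ] E d) = 0 := h0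
    obtain ⟨v, hv, hv0⟩ := (Submodule.ne_bot_iff _).1 (LinearMap.bot_lt_ker_of_det_eq_zero this).ne'
    have h1 := hpos x hx v hv0
    have h2 : S.hess Φ x v = 0 := by simpa using hv
    rw [h2] at h1
    simp at h1
  have hinv : Function.invFunOn (S.grad Φ) S.carrier (S.grad Φ x) = x :=
    hbij.injOn.leftInvOn_invFunOn hx
  rw [push, if_pos (hbij.mapsTo hx), hinv, div_mul_cancel₀ _ hdet]

/-- `F̃(Φ) = F((∇Φ)_# q)`. -/
def lift (S : SampleSpace d) (F : (E d → ℝ) → ℝ) (q : E d → ℝ) (Φ : E d → ℝ) : ℝ :=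
  F (S.push Φ q)

/-- The `L²` first variation of a functional `G`, defined on the set `dom` of functions: `g` is the
first variation of `G` at `f` if, for every smooth curve `c_t`, `0 ≤ t ≤ 1`, in `dom` that starts
at `f`, one has `d/dt G(c_t) = ∫_Ω g(x) ∂_t c_t(x) dx` at `t = 0`. -/
def IsFirstVariation (S : SampleSpace d) (dom : Set (E d → ℝ)) (G : (E d → ℝ) → ℝ)
    (f g : E d → ℝ) : Prop :=
  f ∈ dom ∧ ∀ c : ℝ → E d → ℝ,
    ContDiffOn ℝ ∞ (fun z : ℝ × E d => c z.1 z.2) (Icc (0 : ℝ) 1 ×ˢ S.carrier) →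
    (∀ t ∈ Icc (0 : ℝ) 1, c t ∈ dom) → c 0 = f →
    HasDerivWithinAt (fun t => G (c t))
      (S.integral fun x => g x * derivWithin (fun t => c t x) (Icc (0 : ℝ) 1) 0)
      (Icc (0 : ℝ) 1) 0

/-- The dual variables: smooth functions with zero mean. These are exactly the `Φ*` for which
`∫_Ω Φ Φ* dx` is well defined for `Φ` modulo constants. -/
def duals (S : SampleSpace d) : Set (E d → ℝ) :=
  {f | f ∈ S.smooth ∧ S.integral f = 0}

/-- The values `∫_Ω Φ Φ* dx - G(Φ)`, for `Φ` in the domain `K` of `G`. -/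
def conjValues (S : SampleSpace d) (K : Set (E d → ℝ)) (G : (E d → ℝ) → ℝ) (Φs : E d → ℝ) :
    Set ℝ :=
  {r | ∃ Φ ∈ K, r = S.integral (fun x => Φ x * Φs x) - G Φ}

/-- The `L²` Legendre conjugate `G*(Φ*) = sup_{Φ ∈ K} ∫_Ω Φ Φ* dx - G(Φ)`. -/
def conj (S : SampleSpace d) (K : Set (E d → ℝ)) (G : (E d → ℝ) → ℝ) (Φs : E d → ℝ) : ℝ :=
  sSup (S.conjValues K G Φs)

/-- The `L²` Bregman divergence
`D_G(f₁‖f₂) = G(f₁) - G(f₂) - ∫_Ω (f₁ - f₂) g₂ dx`, with `g₂` the first variation of `G` at `f₂`. -/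
def bregman (S : SampleSpace d) (G : (E d → ℝ) → ℝ) (f₁ f₂ g₂ : E d → ℝ) : ℝ :=
  G f₁ - G f₂ - S.integral fun x => (f₁ x - f₂ x) * g₂ x

/-- The transport Bregman divergence
`D_{T,F}(p‖q) = F(p) - F(q) - ∫_Ω (∇ξ, ∇Φ_p - ∇Φ_q) q dx`, with `ξ` the first variation of `F`
at `q` and `Φ_p` the transport coordinate of `p`. -/
def transportBregman (S : SampleSpace d) (F : (E d → ℝ) → ℝ) (p q Φp ξ : E d → ℝ) : ℝ :=
  F p - F q - S.integral fun x => inner ℝ (S.grad ξ x) (S.grad Φp x - S.grad quad x) * q x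

end SampleSpace

end

/-! Everything rests on two facts about `lift`. It depends on Φ only through ∇Φ, and convexity along
segments of `K` is displacement convexity.

Legendre side. By convexity, a first variation Φ* of F̃ at Φ is a subgradient, so Φ attains the
supremum defining F̃*(Φ*). Invariance under constants forces ∫Φ* = 0. The supremum is finite at
every mean-zero y because transport coordinates have uniformly bounded oscillation on the cell
(`exists_bound_coords`): their gradients take values in the bounded set Ω, or stay at bounded
distance from the identity on the torus. Hence replacing Φ* by y changes the pairing by a bounded
amount. Near Φ* the conjugate lies above the affine functional given by Φ and touches it at Φ*. A
first variation Ψ of F̃* must therefore pair with mean-zero functions exactly as Φ does, so Ψ - Φ is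
constant. This is (i), and inserting the equality case of Fenchel's inequality into both Bregman
divergences gives the first equality of (iii).

Transport side. Along Φ_t = (1 - t)Φ_q + tΦ_p, which stays in `K`, the curve p_t = (∇Φ_t)_# q
satisfies F(p_t) = F̃(Φ_t). The derivative at t = 0 can be computed with either first variation. On
the F side, differentiating ∫ξ p_t = ∫ξ(∇Φ_t) q turns ∫ξ ∂_t p_t into ∫(∇ξ, ∇Φ_p - ∇Φ_q) q; no
integration by parts, hence no boundary term, is involved. Equating the two derivatives is (ii). The
analytic work is to show that p_t is an admissible curve, that is, smooth in (t, x) up to the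
boundary; this needs the inverse maps (∇Φ_t)⁻¹ to be jointly smooth (`contDiffOn_gradInv_interp`).
-/

open Filter Topology

/-! ### Calculus on closed domains -/

/-- A continuous right inverse of a smooth map with invertible derivative is smooth, in the sense of
derivatives within the domains. -/
theorem contDiffOn_of_rightInverse {X Y : Type*} [NormedAddCommGroup X] [NormedSpace ℝ X]
    [CompleteSpace X] [NormedAddCommGroup Y] [NormedSpace ℝ Y]
    {s : Set X} {t : Set Y} {f : X → Y} {g : Y → X} (hs : UniqueDiffOn ℝ s)
    (ht : UniqueDiffOn ℝ t) (hf : ContDiffOn ℝ ∞ f s) (hgs : MapsTo g t s)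
    (hfg : ∀ y ∈ t, f (g y) = y) (hg : ContinuousOn g t)
    (hinv : ∀ x ∈ s, (fderivWithin ℝ f s x).IsInvertible) : ContDiffOn ℝ ∞ g t := by
  have hder : ∀ y ∈ t, HasFDerivWithinAt g (fderivWithin ℝ f s (g y)).inverse t y := by
    intro y hy
    obtain ⟨e, he⟩ := hinv (g y) (hgs hy)
    rw [← he, ContinuousLinearMap.inverse_equiv]
    refine HasFDerivWithinAt.of_local_left_inverse (f := f) (t := s) ?_ ?_ hy ?_
    · exact tendsto_nhdsWithin_iff.2 ⟨hg y hy, eventually_mem_nhdsWithin.mono fun z hz => hgs hz⟩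
    · rw [he]
      exact ((hf.differentiableOn (by simp)) _ (hgs hy)).hasFDerivWithinAt
    · exact eventually_mem_nhdsWithin.mono fun z hz => hfg z hz
  rw [contDiffOn_infty]
  intro n
  -- Bootstrap: `hder` writes the derivative of `g` as inversion composed with Df and `g`, so `g` of
  -- class Cⁿ gives a derivative of class Cⁿ.
  induction n with
  | zero => exact contDiffOn_zero.2 hg
  | succ n ih =>
    have : ((n + 1 : ℕ) : WithTop ℕ∞) = (n : WithTop ℕ∞) + 1 := by push_cast; rfl
    rw [this, contDiffOn_succ_iff_hasFDerivWithinAt_of_uniqueDiffOn ht]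
    refine ⟨fun h => absurd h (by simp), _, ?_, hder⟩
    have h1 : ContDiffOn ℝ n (fderivWithin ℝ f s) s :=
      hf.fderivWithin hs (by exact_mod_cast le_top)
    intro y hy
    obtain ⟨e, he⟩ := hinv (g y) (hgs hy)
    have h2 : ContDiffAt ℝ n ContinuousLinearMap.inverse (fderivWithin ℝ f s (g y)) := by
      rw [← he]; exact contDiffAt_map_inverse e
    exact h2.comp_contDiffWithinAt y ((h1.comp ih hgs) y hy)

theorem contDiff_continuousLinearMap_det {d : ℕ} {n : WithTop ℕ∞} :
    ContDiff ℝ n (fun A : E d →L[ℝ] E d => A.det) := by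
  let b := (EuclideanSpace.basisFun (Fin d) ℝ).toBasis
  have : (fun A : E d →L[ℝ] E d => A.det) = fun A => (Matrix.of fun i j => (A (b j)) i).det := by
    funext A
    rw [ContinuousLinearMap.det, ← LinearMap.det_toMatrix b]
    congr 1
    ext i j
    simp [LinearMap.toMatrix_apply, b]
  rw [this]
  simp only [Matrix.det_apply, Matrix.of_apply]
  refine ContDiff.sum fun σ _ => ContDiff.const_smul _ (contDiff_prod fun i _ => ?_)
  exact ((EuclideanSpace.proj (𝕜 := ℝ) (σ i)).comp
    (ContinuousLinearMap.apply ℝ (E d) (b i))).contDiff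

theorem det_ne_zero_of_inner_pos {d : ℕ} {A : E d →L[ℝ] E d}
    (hA : ∀ v : E d, v ≠ 0 → 0 < inner ℝ (A v) v) : A.det ≠ 0 := by
  intro h0
  have : LinearMap.det (A : E d →ₗ[ℝ] E d) = 0 := h0
  obtain ⟨v, hv, hv0⟩ := (Submodule.ne_bot_iff _).1 (LinearMap.bot_lt_ker_of_det_eq_zero this).ne'
  have h1 := hA v hv0
  have h2 : A v = 0 := by simpa using hv
  simp [h2] at h1

/-- No symmetry of `A` is needed. On the segment from the identity to `A` every operator has a
positive quadratic form, hence a nonzero determinant, and the determinant starts at 1. -/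
theorem det_pos_of_inner_pos {d : ℕ} {A : E d →L[ℝ] E d}
    (hA : ∀ v : E d, v ≠ 0 → 0 < inner ℝ (A v) v) : 0 < A.det := by
  by_contra! hle
  let γ : ℝ → (E d →L[ℝ] E d) := fun t => (1 - t) • ContinuousLinearMap.id ℝ (E d) + t • A
  have hc : ContinuousOn (fun t => (γ t).det) (Icc 0 1) :=
    (ContinuousLinearMap.continuous_det.comp (by fun_prop)).continuousOn
  have h0 : (γ 0).det = 1 := by simp [γ, ContinuousLinearMap.det]
  have h1 : γ 1 = A := by ext v; simp [γ]
  obtain ⟨t, ht, hzero⟩ := intermediate_value_Icc' zero_le_one hc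
    (show (0 : ℝ) ∈ Icc ((γ 1).det) ((γ 0).det) by rw [h0, h1]; exact ⟨hle, zero_le_one⟩)
  refine det_ne_zero_of_inner_pos (A := γ t) (fun v hv => ?_) hzero
  have e : inner ℝ (γ t v) v = (1 - t) * ‖v‖ ^ 2 + t * inner ℝ (A v) v := by
    simp [γ, inner_add_left, inner_smul_left]
  rw [e]
  have hv' : 0 < ‖v‖ ^ 2 := by positivity
  rcases ht.1.eq_or_lt with rfl | h
  · simpa using hv'
  · have := mul_pos h (hA v hv)
    have := mul_nonneg (sub_nonneg.2 ht.2) hv'.le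
    linarith

/-- A map on a convex set whose derivative is bounded below by `m` is strongly monotone. -/
theorem le_inner_sub_of_fderivWithin {d : ℕ} {s : Set (E d)} (hs : Convex ℝ s) {T : E d → E d}
    {T' : E d → E d →L[ℝ] E d} {m : ℝ} (hT : ∀ x ∈ s, HasFDerivWithinAt T (T' x) s x)
    (hm : ∀ x ∈ s, ∀ v, m * ‖v‖ ^ 2 ≤ inner ℝ (T' x v) v) {x y : E d} (hx : x ∈ s) (hy : y ∈ s) :
    m * ‖x - y‖ ^ 2 ≤ inner ℝ (T x - T y) (x - y) := by
  let γ : ℝ → E d := fun r => y + r • (x - y)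
  have hγs : MapsTo γ (Icc 0 1) s := fun r hr => hs.add_smul_sub_mem hy hx hr
  have hγ : ∀ r, HasDerivAt γ (x - y) r := fun r => by
    have := ((hasDerivAt_id r).smul_const (x - y)).const_add y
    rwa [one_smul] at this
  have hd : ∀ r ∈ Icc (0 : ℝ) 1, HasDerivWithinAt (fun r => inner ℝ (T (γ r)) (x - y))
      (inner ℝ (T' (γ r) (x - y)) (x - y)) (Icc 0 1) r := by
    intro r hr
    have h := (hT _ (hγs hr)).comp_hasDerivWithinAt r (hγ r).hasDerivWithinAt hγs
    simpa using h.inner ℝ (hasDerivWithinAt_const r _ (x - y))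
  obtain ⟨r, hr, he⟩ := exists_hasDerivAt_eq_slope (fun r => inner ℝ (T (γ r)) (x - y))
    (fun r => inner ℝ (T' (γ r) (x - y)) (x - y)) zero_lt_one
    (fun r hr => (hd r hr).continuousWithinAt)
    (fun r hr => (hd r (Ioo_subset_Icc_self hr)).hasDerivAt (Icc_mem_nhds hr.1 hr.2))
  have := hm _ (hγs (Ioo_subset_Icc_self hr)) (x - y)
  rw [he] at this
  simpa [γ, inner_sub_left] using this

/-- Differentiation under the integral sign at the left endpoint of `[0, 1]`. -/
theorem hasDerivWithinAt_integral_of_contDiffOn {d : ℕ} {s A C : Set (E d)} (hs : UniqueDiffOn ℝ s)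
    (hA : MeasurableSet A) (hC : IsCompact C) (hAC : A ⊆ C) (hCs : C ⊆ s) {h : ℝ → E d → ℝ}
    (hh : ContDiffOn ℝ ∞ (fun z : ℝ × E d => h z.1 z.2) (Icc (0 : ℝ) 1 ×ˢ s)) :
    HasDerivWithinAt (fun t => ∫ x in A, h t x)
      (∫ x in A, derivWithin (fun t => h t x) (Icc (0 : ℝ) 1) 0) (Icc (0 : ℝ) 1) 0 := by
  have hI : UniqueDiffOn ℝ (Icc (0 : ℝ) 1) := uniqueDiffOn_Icc zero_lt_one
  let D := fderivWithin ℝ (fun z : ℝ × E d => h z.1 z.2) (Icc (0 : ℝ) 1 ×ˢ s)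
  have hD : ∀ t ∈ Icc (0 : ℝ) 1, ∀ x ∈ s,
      HasDerivWithinAt (fun t => h t x) (D (t, x) (1, 0)) (Icc (0 : ℝ) 1) t := by
    intro t ht x hx
    have h1 := (hh.differentiableOn (by simp) (t, x) ⟨ht, hx⟩).hasFDerivWithinAt
    have h2 : HasDerivWithinAt (fun t : ℝ => (t, x)) ((1 : ℝ), (0 : E d)) (Icc (0 : ℝ) 1) t :=
      (hasDerivWithinAt_id t _).prodMk (hasDerivWithinAt_const t _ x)
    exact h1.comp_hasDerivWithinAt t h2 (fun r hr => (⟨hr, hx⟩ : (r, x) ∈ Icc (0 : ℝ) 1 ×ˢ s))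
  have hDc : ContinuousOn (fun z => D z (1, 0)) (Icc (0 : ℝ) 1 ×ˢ s) :=
    (hh.continuousOn_fderivWithin (hI.prod hs) (by simp)).clm_apply continuousOn_const
  obtain ⟨M, hM⟩ := (isCompact_Icc.prod hC).exists_bound_of_continuousOn
    (hDc.mono (prod_mono Subset.rfl hCs))
  have hfin : volume A ≠ ⊤ := (lt_of_le_of_lt (measure_mono hAC) hC.measure_lt_top).ne
  have : IsFiniteMeasure (volume.restrict A) := isFiniteMeasure_restrict.2 hfin
  have hcont : ∀ t ∈ Icc (0 : ℝ) 1, ContinuousOn (h t) C := fun t ht =>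
    hh.continuousOn.comp (f := fun x => (t, x)) (by fun_prop) fun x hx => ⟨ht, hCs hx⟩
  have hint : ∀ t ∈ Icc (0 : ℝ) 1, IntegrableOn (h t) A := fun t ht =>
    ((hcont t ht).integrableOn_compact hC).mono_set hAC
  have h0 : (0 : ℝ) ∈ Icc (0 : ℝ) 1 := by simp
  rw [hasDerivWithinAt_iff_tendsto_slope]
  have key : Tendsto (fun t : ℝ => ∫ x in A, slope (fun t => h t x) 0 t)
      (𝓝[Icc (0 : ℝ) 1 \ {0}] 0)
      (𝓝 (∫ x in A, derivWithin (fun t => h t x) (Icc (0 : ℝ) 1) 0)) := by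
    refine tendsto_integral_filter_of_dominated_convergence (fun _ => M) ?_ ?_
      (integrable_const M) ?_
    · filter_upwards [self_mem_nhdsWithin] with t ht
      simp only [slope_def_module]
      exact (((hint t ht.1).sub (hint 0 h0)).aestronglyMeasurable).const_smul (t - 0)⁻¹
    -- The mean value inequality bounds the difference quotients by `M`, the maximum of the time
    -- derivative over the compact set [0, 1] × C.
    · filter_upwards [self_mem_nhdsWithin] with t ht
      filter_upwards [ae_restrict_mem hA] with x hx
      have h1 := Convex.norm_image_sub_le_of_norm_hasDerivWithin_le
        (fun r hr => hD r hr x (hCs (hAC hx))) (fun r hr => hM (r, x) ⟨hr, hAC hx⟩)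
        (convex_Icc 0 1) h0 ht.1
      have ht0 : 0 < t := lt_of_le_of_ne ht.1.1 (Ne.symm ht.2)
      rw [slope_def_module, norm_smul, norm_inv, sub_zero, inv_mul_le_iff₀ (norm_pos_iff.2 ht0.ne')]
      simpa [mul_comm] using h1
    · filter_upwards [ae_restrict_mem hA] with x hx
      have h1 := hD 0 h0 x (hCs (hAC hx))
      rw [h1.derivWithin (hI 0 h0)]
      exact hasDerivWithinAt_iff_tendsto_slope.1 h1
  refine key.congr' ?_
  filter_upwards [self_mem_nhdsWithin] with t ht
  simp only [slope_def_module]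
  rw [integral_smul, integral_sub (hint t ht.1) (hint 0 h0)]

namespace SampleSpace

variable {d : ℕ}

/-! ### Geometry of the sample space -/

theorem convex_carrier (S : SampleSpace d) : Convex ℝ S.carrier := by
  cases S with
  | body Ω hc hv hi => exact hv
  | torus => exact convex_univ

theorem interior_carrier_nonempty (S : SampleSpace d) : (interior S.carrier).Nonempty := by
  cases S with
  | body Ω hc hv hi => exact hi
  | torus => simp [carrier]

theorem uniqueDiffOn_carrier (S : SampleSpace d) : UniqueDiffOn ℝ S.carrier :=
  uniqueDiffOn_convex S.convex_carrier S.interior_carrier_nonempty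

theorem uniqueDiffOn_prod_carrier (S : SampleSpace d) :
    UniqueDiffOn ℝ (Icc (0 : ℝ) 1 ×ˢ S.carrier) :=
  (uniqueDiffOn_Icc zero_lt_one).prod S.uniqueDiffOn_carrier

theorem measurableSet_cell (S : SampleSpace d) : MeasurableSet S.cell := by
  cases S with
  | body Ω hc hv hi => exact hc.measurableSet
  | torus =>
    have : (torus : SampleSpace d).cell = ⋂ i, {x : E d | x i ∈ Ico (0 : ℝ) 1} := by
      ext; simp [cell]
    rw [this]
    exact MeasurableSet.iInter fun i =>
      measurableSet_Ico.preimage (EuclideanSpace.proj (𝕜 := ℝ) i).continuous.measurable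

theorem add_mem_carrier (S : SampleSpace d) {v : E d} (hv : v ∈ S.periods) {x : E d} :
    x + v ∈ S.carrier ↔ x ∈ S.carrier := by
  cases S with
  | body Ω hc hv hi => simp_all [periods]
  | torus => simp [carrier]

theorem cell_subset_carrier (S : SampleSpace d) : S.cell ⊆ S.carrier := by
  cases S with
  | body Ω hc hv hi => exact Subset.rfl
  | torus => exact subset_univ _

/-- A compact set of representatives containing the cell. -/
def closedCell : SampleSpace d → Set (E d)
  | body Ω _ _ _ => Ω
  | torus => {x | ∀ i, x i ∈ Icc (0 : ℝ) 1}

theorem isCompact_closedCell (S : SampleSpace d) : IsCompact S.closedCell := by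
  cases S with
  | body Ω hc hv hi => exact hc
  | torus =>
    have h : IsCompact (univ.pi fun _ : Fin d => Icc (0 : ℝ) 1) :=
      isCompact_univ_pi fun _ => isCompact_Icc
    have := h.image (PiLp.continuous_toLp 2 fun _ : Fin d => ℝ)
    convert this using 1
    ext x
    constructor
    · exact fun hx => ⟨fun i => x i, fun i _ => hx i, rfl⟩
    · rintro ⟨y, hy, rfl⟩ i
      exact hy i (mem_univ i)

theorem cell_subset_closedCell (S : SampleSpace d) : S.cell ⊆ S.closedCell := by
  cases S with
  | body Ω hc hv hi => exact Subset.rfl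
  | torus => exact fun x hx i => Ico_subset_Icc_self (hx i)

theorem closedCell_subset_carrier (S : SampleSpace d) : S.closedCell ⊆ S.carrier := by
  cases S with
  | body Ω hc hv hi => exact Subset.rfl
  | torus => exact subset_univ _

theorem exists_add_mem_cell (S : SampleSpace d) {x : E d} (hx : x ∈ S.carrier) :
    ∃ v ∈ S.periods, x + v ∈ S.cell := by
  cases S with
  | body Ω hc hv hi => exact ⟨0, mem_singleton _, by simpa using! hx⟩
  | torus =>
    refine ⟨WithLp.toLp 2 fun i => ((-⌊x i⌋ : ℤ) : ℝ), fun i => ⟨-⌊x i⌋, rfl⟩, fun i => ?_⟩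
    have h1 := Int.floor_le (x i)
    have h2 := Int.lt_floor_add_one (x i)
    simp only [PiLp.add_apply, Int.cast_neg, mem_Ico]
    constructor <;> linarith

theorem integrableOn_cell (S : SampleSpace d) {f : E d → ℝ} (hf : ContinuousOn f S.carrier) :
    IntegrableOn f S.cell :=
  ((hf.mono S.closedCell_subset_carrier).integrableOn_compact S.isCompact_closedCell).mono_set
    S.cell_subset_closedCell

/-- A smooth function that vanishes almost everywhere on the cell vanishes identically. -/
theorem eqOn_carrier_of_ae_cell (S : SampleSpace d) {f : E d → ℝ} (hf : f ∈ S.smooth)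
    (h0 : f =ᵐ[volume.restrict S.cell] 0) : EqOn f 0 S.carrier := by
  cases S with
  | body Ω hc hv hi =>
    refine Measure.eqOn_of_ae_eq h0 hf.1.continuousOn continuousOn_const ?_
    rw [carrier, hv.closure_interior_eq_closure_of_nonempty_interior hi]
    exact subset_closure
  | torus =>
    have hcont : Continuous f := by
      have := hf.1.continuousOn
      rwa [carrier, continuousOn_univ] at this
    have hcell : ∀ᵐ x ∂(volume : Measure (E d)), x ∈ (torus : SampleSpace d).cell → f x = 0 :=
      (ae_restrict_iff' (torus : SampleSpace d).measurableSet_cell).1 h0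
    -- Countably many integer translates of a null set are still null, so the vanishing spreads from
    -- the cell to the whole space by periodicity.
    have hall : ∀ᵐ x ∂(volume : Measure (E d)), ∀ n : Fin d → ℤ,
        (x + WithLp.toLp 2 fun i => (n i : ℝ)) ∈ (torus : SampleSpace d).cell →
          f (x + WithLp.toLp 2 fun i => (n i : ℝ)) = 0 :=
      ae_all_iff.2 fun n =>
        (measurePreserving_add_right volume
          (WithLp.toLp 2 fun i => (n i : ℝ))).quasiMeasurePreserving.ae
          hcell
    have : f =ᵐ[volume] 0 := by
      filter_upwards [hall] with x hx
      obtain ⟨v, hv, hxv⟩ := (torus : SampleSpace d).exists_add_mem_cell (mem_univ x)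
      rw [Pi.zero_apply, ← hf.2 v hv x]
      choose n hn using hv
      have e : v = WithLp.toLp 2 fun i => (n i : ℝ) := by ext i; exact hn i
      rw [e] at hxv ⊢
      exact hx n hxv
    rw [(hcont.ae_eq_iff_eq volume continuous_const).1 this]
    exact fun _ _ => rfl

/-- Otherwise the constant function 1 would vanish almost everywhere on the cell, hence identically.
-/
theorem volume_cell_ne_zero (S : SampleSpace d) : volume S.cell ≠ 0 := by
  intro h
  obtain ⟨x, hx⟩ := S.interior_carrier_nonempty
  have h1 : (fun _ : E d => (1 : ℝ)) ∈ S.smooth := ⟨contDiffOn_const, fun _ _ _ => rfl⟩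
  have := S.eqOn_carrier_of_ae_cell h1 (by rw [Measure.restrict_eq_zero.2 h]; rfl)
    (interior_subset hx)
  simp at this

/-- A bijection that commutes with the periods transports the cell to another cell. -/
theorem setIntegral_image_cell (S : SampleSpace d) {T : E d → E d} (hT : ContinuousOn T S.carrier)
    (hbij : BijOn T S.carrier S.carrier)
    (hper : ∀ v ∈ S.periods, ∀ x ∈ S.carrier, T (x + v) = T x + v) {f : E d → ℝ}
    (hf : ∀ v ∈ S.periods, ∀ x, f (x + v) = f x) :
    ∫ x in T '' S.cell, f x = ∫ x in S.cell, f x := by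
  cases S with
  | body Ω hc hv hi =>
    have : T '' Ω = Ω := hbij.image_eq
    simp only [cell, this]
  | torus =>
    let b := (EuclideanSpace.basisFun (Fin d) ℝ).toBasis
    have hcell : (torus : SampleSpace d).cell = ZSpan.fundamentalDomain b := by
      ext x; simp [cell, ZSpan.mem_fundamentalDomain, b]
    have hmem : ∀ v : E d, v ∈ Submodule.span ℤ (range b) ↔ v ∈ (torus : SampleSpace d).periods := by
      intro v
      rw [b.mem_span_iff_repr_mem ℤ]
      simp [periods, b, eq_comm]
    have hdom := ZSpan.isAddFundamentalDomain b (volume : Measure (E d))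
    rw [← hcell] at hdom
    have : VAddInvariantMeasure (Submodule.span ℤ (range b)) (E d) volume :=
      ⟨fun c s _ => measure_preimage_add volume (c : E d) s⟩
    -- The image of the cell is again a fundamental domain for ℤ^d, since `T` is bijective and
    -- commutes with the translations; periodic functions have the same integral over both.
    refine IsAddFundamentalDomain.setIntegral_eq (G := Submodule.span ℤ (range b)) ?_ hdom ?_
    · refine IsAddFundamentalDomain.mk' ?_ ?_
      · exact (torus : SampleSpace d).measurableSet_cell.image_of_continuousOn_injOn
          (hT.mono (subset_univ _)) (hbij.injOn.mono (subset_univ _)) |>.nullMeasurableSet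
      · intro y
        obtain ⟨x, -, rfl⟩ := hbij.surjOn (mem_univ y)
        obtain ⟨g, hg, huniq⟩ := ZSpan.exist_unique_vadd_mem_fundamentalDomain b x
        have hgT : ∀ g : Submodule.span ℤ (range b), g +ᵥ T x = T (g +ᵥ x) := by
          intro g
          have := hper g ((hmem _).1 g.2) x (mem_univ x)
          simp only [Submodule.vadd_def, vadd_eq_add]
          rw [add_comm, ← this, add_comm]
        have hin : ∀ g : Submodule.span ℤ (range b),
            g +ᵥ T x ∈ T '' (torus : SampleSpace d).cell ↔ g +ᵥ x ∈ ZSpan.fundamentalDomain b := by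
          intro g
          rw [hgT, hbij.injOn.mem_image_iff (subset_univ _) (mem_univ _), hcell]
        exact ⟨g, (hin g).2 hg, fun g' hg' => huniq g' ((hin g').1 hg')⟩
    · intro g x
      have := hf g ((hmem _).1 g.2) x
      rwa [Submodule.vadd_def, vadd_eq_add, add_comm]

/-! ### Gradients and Hessians of potentials -/

theorem contDiff_quad : ContDiff ℝ ∞ (quad : E d → ℝ) :=
  (contDiff_norm_sq ℝ).div_const 2

theorem hasFDerivAt_quad (x : E d) : HasFDerivAt (quad : E d → ℝ) (innerSL ℝ x) x := by
  have h := (hasStrictFDerivAt_norm_sq x).hasFDerivAt.mul_const (2⁻¹ : ℝ)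
  refine (h.congr_fderiv ?_ : HasFDerivAt (fun y : E d => ‖y‖ ^ 2 * 2⁻¹) (innerSL ℝ x) x)
  ext v
  simp

theorem contDiffOn_of_mem_potentials (S : SampleSpace d) {Φ : E d → ℝ} (hΦ : Φ ∈ S.potentials) :
    ContDiffOn ℝ ∞ Φ S.carrier := by
  cases S with
  | body Ω hc hv hi => exact hΦ
  | torus => simpa using! hΦ.1.add (contDiff_quad (d := d)).contDiffOn

theorem hasFDerivWithinAt_innerSL_grad (S : SampleSpace d) {f : E d → ℝ} {x : E d}
    (hf : DifferentiableWithinAt ℝ f S.carrier x) :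
    HasFDerivWithinAt f (innerSL ℝ (S.grad f x)) S.carrier x := by
  have := hf.hasGradientWithinAt.hasFDerivWithinAt
  exact this

theorem grad_eq_of_hasFDerivWithinAt (S : SampleSpace d) {f : E d → ℝ} {x w : E d}
    (hx : x ∈ S.carrier) (hf : HasFDerivWithinAt f (innerSL ℝ w) S.carrier x) :
    S.grad f x = w := by
  have h1 : fderivWithin ℝ f S.carrier x = innerSL ℝ w :=
    hf.fderivWithin (S.uniqueDiffOn_carrier x hx)
  rw [grad, gradientWithin, h1]
  exact (InnerProductSpace.toDual ℝ (E d)).symm_apply_apply w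

theorem contDiffOn_grad (S : SampleSpace d) {f : E d → ℝ} (hf : ContDiffOn ℝ ∞ f S.carrier) :
    ContDiffOn ℝ ∞ (S.grad f) S.carrier :=
  (InnerProductSpace.toDual ℝ (E d)).symm.toContinuousLinearEquiv.contDiff.comp_contDiffOn
    (hf.fderivWithin S.uniqueDiffOn_carrier (by simp))

theorem contDiffOn_hess (S : SampleSpace d) {f : E d → ℝ} (hf : ContDiffOn ℝ ∞ f S.carrier) :
    ContDiffOn ℝ ∞ (S.hess f) S.carrier :=
  (S.contDiffOn_grad hf).fderivWithin S.uniqueDiffOn_carrier (by simp)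

theorem hasFDerivWithinAt_grad (S : SampleSpace d) {f : E d → ℝ}
    (hf : ContDiffOn ℝ ∞ f S.carrier) {x : E d} (hx : x ∈ S.carrier) :
    HasFDerivWithinAt (S.grad f) (S.hess f x) S.carrier x :=
  ((S.contDiffOn_grad hf).differentiableOn (by simp) x hx).hasFDerivWithinAt

theorem hess_eq_of_eqOn (S : SampleSpace d) {f : E d → ℝ} {T : E d → E d}
    (hT : EqOn (S.grad f) T S.carrier) {A : E d →L[ℝ] E d} {x : E d} (hx : x ∈ S.carrier)
    (hA : HasFDerivWithinAt T A S.carrier x) : S.hess f x = A :=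
  (hA.congr hT (hT hx)).fderivWithin (S.uniqueDiffOn_carrier x hx)

theorem grad_add_const (S : SampleSpace d) (f : E d → ℝ) (a : ℝ) :
    S.grad (fun x => f x + a) = S.grad f := by
  funext x
  simp only [grad, gradientWithin, fderivWithin_add_const]

theorem push_add_const (S : SampleSpace d) (f q : E d → ℝ) (a : ℝ) :
    S.push (fun x => f x + a) q = S.push f q := by
  unfold push hess
  rw [grad_add_const]

theorem grad_quad (S : SampleSpace d) {x : E d} (hx : x ∈ S.carrier) : S.grad quad x = x :=
  S.grad_eq_of_hasFDerivWithinAt hx (hasFDerivAt_quad x).hasFDerivWithinAt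

theorem hess_quad (S : SampleSpace d) {x : E d} (hx : x ∈ S.carrier) :
    S.hess quad x = ContinuousLinearMap.id ℝ (E d) :=
  S.hess_eq_of_eqOn (fun _ h => S.grad_quad h) hx (hasFDerivWithinAt_id x _)

/-- The displacement interpolation between the potential of the identity and `Φ`. -/
noncomputable def interp (Φ : E d → ℝ) (t : ℝ) : E d → ℝ := (1 - t) • quad + t • Φ

theorem grad_interp (S : SampleSpace d) {Φ : E d → ℝ} (hΦ : ContDiffOn ℝ ∞ Φ S.carrier) (t : ℝ)
    {x : E d} (hx : x ∈ S.carrier) :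
    S.grad (interp Φ t) x = x + t • (S.grad Φ x - x) := by
  refine S.grad_eq_of_hasFDerivWithinAt hx ?_
  have h1 := (hasFDerivAt_quad x).hasFDerivWithinAt (s := S.carrier) |>.const_smul (1 - t)
  have h2 := (S.hasFDerivWithinAt_innerSL_grad (hΦ.differentiableOn (by simp) x hx)).const_smul t
  refine (h1.add h2).congr_fderiv ?_
  ext v
  simp
  ring

theorem hess_interp (S : SampleSpace d) {Φ : E d → ℝ} (hΦ : ContDiffOn ℝ ∞ Φ S.carrier) (t : ℝ)
    {x : E d} (hx : x ∈ S.carrier) :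
    S.hess (interp Φ t) x =
      ContinuousLinearMap.id ℝ (E d) + t • (S.hess Φ x - ContinuousLinearMap.id ℝ (E d)) :=
  S.hess_eq_of_eqOn (fun _ h => S.grad_interp hΦ t h) hx <|
    (hasFDerivWithinAt_id x _).add
      (((S.hasFDerivWithinAt_grad hΦ hx).sub (hasFDerivWithinAt_id x _)).const_smul t)

theorem sub_mem_smooth (S : SampleSpace d) {Φ Ψ : E d → ℝ} (hΦ : Φ ∈ S.potentials)
    (hΨ : Ψ ∈ S.potentials) : (fun x => Φ x - Ψ x) ∈ S.smooth := by
  refine ⟨(S.contDiffOn_of_mem_potentials hΦ).sub (S.contDiffOn_of_mem_potentials hΨ), ?_⟩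
  intro v hv x
  cases S with
  | body Ω hc hv hi => simp_all [periods]
  | torus =>
    have h1 := hΦ.2 v hv x
    have h2 := hΨ.2 v hv x
    dsimp only at h1 h2 ⊢
    linarith

theorem grad_add_period (S : SampleSpace d) {Φ : E d → ℝ} (hΦ : Φ ∈ S.potentials) {v : E d}
    (hv : v ∈ S.periods) {x : E d} (hx : x ∈ S.carrier) : S.grad Φ (x + v) = S.grad Φ x + v := by
  cases S with
  | body Ω hc hcv hi => rw [show v = 0 from hv]; simp
  | torus =>
    have hd := contDiffOn_of_mem_potentials _ hΦ
    have h1 := hasFDerivWithinAt_innerSL_grad _ (hd.differentiableOn (by simp) (x + v) (mem_univ _))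
    have h2 := hasFDerivWithinAt_innerSL_grad _ (hd.differentiableOn (by simp) x (mem_univ _))
    simp only [carrier, hasFDerivWithinAt_univ] at h1 h2
    have h3 : HasFDerivAt (fun y => Φ (y + v)) (innerSL ℝ (torus.grad Φ (x + v))) x :=
      (hasFDerivAt_comp_add_right v).2 h1
    -- Periodicity of Φ - ‖·‖²/2, with the square expanded: a translation by a period adds an affine
    -- function with gradient `v`.
    have e : (fun y => Φ (y + v)) = fun y => Φ y + (inner ℝ v y + quad v) := by
      funext y
      have h := hΦ.2 v hv y
      have := norm_add_sq_real y v
      have := real_inner_comm v y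
      simp only [quad] at h ⊢
      linarith
    rw [e] at h3
    have h4 : HasFDerivAt (fun y => Φ y + (inner ℝ v y + quad v))
        (innerSL ℝ (torus.grad Φ x) + innerSL ℝ v) x :=
      h2.add ((innerSL ℝ v).hasFDerivAt.add_const _)
    have := h3.unique h4
    rw [← map_add] at this
    exact ((InnerProductSpace.toDual ℝ (E d)).injective (by exact this))

theorem hess_add_period (S : SampleSpace d) {Φ : E d → ℝ} (hΦ : Φ ∈ S.potentials) {v : E d}
    (hv : v ∈ S.periods) {x : E d} (hx : x ∈ S.carrier) : S.hess Φ (x + v) = S.hess Φ x := by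
  cases S with
  | body Ω hc hcv hi => rw [show v = 0 from hv]; simp
  | torus =>
    have hd := contDiffOn_of_mem_potentials _ hΦ
    have h1 := hasFDerivWithinAt_grad _ hd (mem_univ (x + v))
    have h2 := hasFDerivWithinAt_grad _ hd (mem_univ x)
    simp only [carrier, hasFDerivWithinAt_univ] at h1 h2
    have h3 : HasFDerivAt (fun y => torus.grad Φ (y + v)) (torus.hess Φ (x + v)) x :=
      (hasFDerivAt_comp_add_right v).2 h1
    have e : (fun y => torus.grad Φ (y + v)) = fun y => torus.grad Φ y + v :=
      funext fun y => grad_add_period _ hΦ hv (mem_univ y)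
    rw [e] at h3
    exact h3.unique (h2.add_const v)

/-- The Hessian of a transport coordinate is uniformly positive definite. -/
theorem exists_le_hess (S : SampleSpace d) {Φ : E d → ℝ} (hΦ : Φ ∈ S.coords) :
    ∃ m : ℝ, 0 < m ∧ m ≤ 1 ∧
      ∀ x ∈ S.carrier, ∀ v : E d, m * ‖v‖ ^ 2 ≤ inner ℝ (S.hess Φ x v) v := by
  obtain ⟨hpot, hpos, -⟩ := hΦ
  have hc := S.contDiffOn_of_mem_potentials hpot
  suffices h : ∃ m : ℝ, 0 < m ∧ ∀ x ∈ S.closedCell, ∀ v ∈ Metric.sphere (0 : E d) 1,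
      m ≤ inner ℝ (S.hess Φ x v) v by
    obtain ⟨m, hm, h⟩ := h
    -- The cap at 1 makes the same constant a lower bound for the Hessian of ‖·‖²/2, and so for all
    -- interpolants.
    refine ⟨min m 1, lt_min hm one_pos, min_le_right _ _, fun x hx v => ?_⟩
    refine (mul_le_mul_of_nonneg_right (min_le_left m 1) (by positivity)).trans ?_
    obtain ⟨w, hw, hxw⟩ := S.exists_add_mem_cell hx
    rw [← S.hess_add_period hpot hw hx]
    rcases eq_or_ne v 0 with rfl | hv
    · simp
    · have hv' : 0 < ‖v‖ := norm_pos_iff.2 hv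
      have := h _ (S.cell_subset_closedCell hxw) (‖v‖⁻¹ • v) (by simp [norm_smul, hv'.ne'])
      rw [map_smul, inner_smul_left, inner_smul_right] at this
      have h2 := mul_le_mul_of_nonneg_right this (sq_nonneg ‖v‖)
      refine h2.trans_eq ?_
      simp only [conj_trivial]
      field_simp
  -- The unit sphere is empty when d = 0.
  rcases (S.closedCell ×ˢ Metric.sphere (0 : E d) 1).eq_empty_or_nonempty with h0 | hne
  · refine ⟨1, one_pos, fun x hx v hv => ?_⟩
    have : (x, v) ∈ S.closedCell ×ˢ Metric.sphere (0 : E d) 1 := ⟨hx, hv⟩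
    simp [h0] at this
  · have hcont : ContinuousOn (fun z : E d × E d => inner ℝ (S.hess Φ z.1 z.2) z.2)
        (S.closedCell ×ˢ Metric.sphere (0 : E d) 1) := by
      refine ContinuousOn.inner (ContinuousOn.clm_apply ?_ continuousOn_snd) continuousOn_snd
      exact (S.contDiffOn_hess hc).continuousOn.comp continuousOn_fst
        fun z hz => S.closedCell_subset_carrier hz.1
    obtain ⟨z, hz, hmin⟩ := (S.isCompact_closedCell.prod (isCompact_sphere _ _)).exists_isMinOn
      hne hcont
    refine ⟨inner ℝ (S.hess Φ z.1 z.2) z.2, hpos _ (S.closedCell_subset_carrier hz.1) _ ?_,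
      fun x hx v hv => hmin (show (x, v) ∈ _ from ⟨hx, hv⟩)⟩
    intro h
    have := hz.2
    simp [h] at this

/-! ### Push-forward densities -/

/-- The inverse `(∇Φ)⁻¹` used in the definition of the push-forward. -/
noncomputable def gradInv (S : SampleSpace d) (Φ : E d → ℝ) : E d → E d :=
  Function.invFunOn (S.grad Φ) S.carrier

theorem gradInv_mem (S : SampleSpace d) {Φ : E d → ℝ} (hΦ : Φ ∈ S.coords) {y : E d}
    (hy : y ∈ S.carrier) : S.gradInv Φ y ∈ S.carrier :=
  Function.invFunOn_mem (hΦ.2.2.surjOn hy)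

theorem grad_gradInv (S : SampleSpace d) {Φ : E d → ℝ} (hΦ : Φ ∈ S.coords) {y : E d}
    (hy : y ∈ S.carrier) : S.grad Φ (S.gradInv Φ y) = y :=
  Function.invFunOn_eq (hΦ.2.2.surjOn hy)

theorem gradInv_grad (S : SampleSpace d) {Φ : E d → ℝ} (hΦ : Φ ∈ S.coords) {x : E d}
    (hx : x ∈ S.carrier) : S.gradInv Φ (S.grad Φ x) = x :=
  hΦ.2.2.injOn.leftInvOn_invFunOn hx

theorem det_hess_pos (S : SampleSpace d) {Φ : E d → ℝ} (hΦ : Φ ∈ S.coords) {x : E d}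
    (hx : x ∈ S.carrier) : 0 < (S.hess Φ x).det :=
  det_pos_of_inner_pos (hΦ.2.1 x hx)

theorem push_of_mem (S : SampleSpace d) (Φ q : E d → ℝ) {y : E d} (hy : y ∈ S.carrier) :
    S.push Φ q y = q (S.gradInv Φ y) / (S.hess Φ (S.gradInv Φ y)).det := if_pos hy

theorem push_of_notMem (S : SampleSpace d) (Φ q : E d → ℝ) {y : E d} (hy : y ∉ S.carrier) :
    S.push Φ q y = 0 := if_neg hy

/-- The Jacobian equation fixes the density only on the carrier; the convention of extension by zero
makes this an equality of functions, which is needed because F is applied to functions on all of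
ℝ^d. -/
theorem push_eq_of_isPush (S : SampleSpace d) {Φ p q : E d → ℝ} (hΦ : Φ ∈ S.coords)
    (h0 : ∀ x, x ∉ S.carrier → p x = 0) (h : S.IsPush Φ q p) : S.push Φ q = p := by
  funext y
  by_cases hy : y ∈ S.carrier
  · have hx := S.gradInv_mem hΦ hy
    have h1 := h _ hx
    rw [S.grad_gradInv hΦ hy] at h1
    rw [S.push_of_mem _ _ hy, div_eq_iff (S.det_hess_pos hΦ hx).ne', h1]
  · rw [S.push_of_notMem _ _ hy, h0 y hy]

theorem push_quad (S : SampleSpace d) {q : E d → ℝ} (hquad : (quad : E d → ℝ) ∈ S.coords)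
    (h0 : ∀ x, x ∉ S.carrier → q x = 0) : S.push quad q = q :=
  S.push_eq_of_isPush hquad h0 fun x hx => by
    rw [S.grad_quad hx, S.hess_quad hx]
    simp [ContinuousLinearMap.det]

theorem push_add_period (S : SampleSpace d) {Φ q : E d → ℝ} (hΦ : Φ ∈ S.coords)
    (hq : ∀ v ∈ S.periods, ∀ x, q (x + v) = q x) {v : E d} (hv : v ∈ S.periods) (y : E d) :
    S.push Φ q (y + v) = S.push Φ q y := by
  by_cases hy : y ∈ S.carrier
  · have hyv := (S.add_mem_carrier hv).2 hy
    have hx := S.gradInv_mem hΦ hy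
    have hinv : S.gradInv Φ (y + v) = S.gradInv Φ y + v := by
      have h1 := S.grad_add_period hΦ.1 hv hx
      rw [S.grad_gradInv hΦ hy] at h1
      rw [← h1, S.gradInv_grad hΦ ((S.add_mem_carrier hv).2 hx)]
    rw [S.push_of_mem _ _ hyv, S.push_of_mem _ _ hy, hinv, hq v hv,
      S.hess_add_period hΦ.1 hv hx]
  · rw [S.push_of_notMem _ _ hy, S.push_of_notMem _ _ ((S.add_mem_carrier hv).not.2 hy)]

theorem push_nonneg (S : SampleSpace d) {Φ q : E d → ℝ} (hΦ : Φ ∈ S.coords)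
    (hq : ∀ x, 0 ≤ q x) (y : E d) : 0 ≤ S.push Φ q y := by
  by_cases hy : y ∈ S.carrier
  · rw [S.push_of_mem _ _ hy]
    exact div_nonneg (hq _) (S.det_hess_pos hΦ (S.gradInv_mem hΦ hy)).le
  · rw [S.push_of_notMem _ _ hy]

/-- Change of variables for the push-forward density. -/
theorem integral_mul_push (S : SampleSpace d) {Φ f q : E d → ℝ} (hΦ : Φ ∈ S.coords)
    (hq : ∀ v ∈ S.periods, ∀ x, q (x + v) = q x) (hf : ∀ v ∈ S.periods, ∀ x, f (x + v) = f x) :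
    S.integral (fun y => f y * S.push Φ q y) = S.integral fun x => f (S.grad Φ x) * q x := by
  have hc := S.contDiffOn_of_mem_potentials hΦ.1
  have hsub := S.cell_subset_carrier
  -- On the torus ∇Φ need not preserve the cell, so the left integral is first moved to the image of
  -- the cell, where the change of variables applies.
  rw [integral, integral, ← S.setIntegral_image_cell (S.contDiffOn_grad hc).continuousOn hΦ.2.2
    (fun v hv x hx => S.grad_add_period hΦ.1 hv hx)
    (fun v hv x => by rw [hf v hv, S.push_add_period hΦ hq hv]),
    integral_image_eq_integral_abs_det_fderiv_smul volume S.measurableSet_cell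
      (fun x hx => (S.hasFDerivWithinAt_grad hc (hsub hx)).mono hsub) (hΦ.2.2.injOn.mono hsub)]
  refine setIntegral_congr_fun S.measurableSet_cell fun x hx => ?_
  have h1 := S.isPush_push hΦ q x (hsub hx)
  simp only [smul_eq_mul]
  rw [← h1, abs_of_pos (S.det_hess_pos hΦ (hsub hx))]
  ring

/-! ### The displacement interpolation -/

theorem contDiffOn_interp (S : SampleSpace d) {Φ : E d → ℝ}
    (hΦ : ContDiffOn ℝ ∞ Φ S.carrier) :
    ContDiffOn ℝ ∞ (fun z : ℝ × E d => interp Φ z.1 z.2) (Icc (0 : ℝ) 1 ×ˢ S.carrier) := by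
  have h1 : ContDiffOn ℝ ∞ (fun z : ℝ × E d => Φ z.2) (Icc (0 : ℝ) 1 ×ˢ S.carrier) :=
    hΦ.comp contDiffOn_snd fun z hz => hz.2
  have h2 : ContDiffOn ℝ ∞ (fun z : ℝ × E d => quad z.2) (Icc (0 : ℝ) 1 ×ˢ S.carrier) :=
    (contDiff_quad.comp contDiff_snd).contDiffOn
  exact ((contDiffOn_const.sub contDiffOn_fst).mul h2).add (contDiffOn_fst.mul h1)

theorem contDiffOn_grad_interp (S : SampleSpace d) {Φ : E d → ℝ}
    (hΦ : ContDiffOn ℝ ∞ Φ S.carrier) :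
    ContDiffOn ℝ ∞ (fun z : ℝ × E d => S.grad (interp Φ z.1) z.2)
      (Icc (0 : ℝ) 1 ×ˢ S.carrier) := by
  have h1 : ContDiffOn ℝ ∞ (fun z : ℝ × E d => S.grad Φ z.2) (Icc (0 : ℝ) 1 ×ˢ S.carrier) :=
    (S.contDiffOn_grad hΦ).comp contDiffOn_snd fun z hz => hz.2
  exact (contDiffOn_snd.add (contDiffOn_fst.smul (h1.sub contDiffOn_snd))).congr
    fun z hz => S.grad_interp hΦ z.1 hz.2

theorem contDiffOn_hess_interp (S : SampleSpace d) {Φ : E d → ℝ}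
    (hΦ : ContDiffOn ℝ ∞ Φ S.carrier) :
    ContDiffOn ℝ ∞ (fun z : ℝ × E d => S.hess (interp Φ z.1) z.2)
      (Icc (0 : ℝ) 1 ×ˢ S.carrier) := by
  have h1 : ContDiffOn ℝ ∞ (fun z : ℝ × E d => S.hess Φ z.2) (Icc (0 : ℝ) 1 ×ˢ S.carrier) :=
    (S.contDiffOn_hess hΦ).comp contDiffOn_snd fun z hz => hz.2
  exact (contDiffOn_const.add (contDiffOn_fst.smul (h1.sub contDiffOn_const))).congr
    fun z hz => S.hess_interp hΦ z.1 hz.2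

theorem hasFDerivWithinAt_grad_interp (S : SampleSpace d) {Φ : E d → ℝ}
    (hΦ : ContDiffOn ℝ ∞ Φ S.carrier) {z : ℝ × E d} (hz : z ∈ Icc (0 : ℝ) 1 ×ˢ S.carrier) :
    HasFDerivWithinAt (fun z : ℝ × E d => S.grad (interp Φ z.1) z.2)
      ((ContinuousLinearMap.fst ℝ ℝ (E d)).smulRight (S.grad Φ z.2 - z.2) +
        (S.hess (interp Φ z.1) z.2).comp (ContinuousLinearMap.snd ℝ ℝ (E d)))
      (Icc (0 : ℝ) 1 ×ˢ S.carrier) z := by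
  have h1 : HasFDerivWithinAt (fun z : ℝ × E d => S.grad Φ z.2)
      ((S.hess Φ z.2).comp (ContinuousLinearMap.snd ℝ ℝ (E d))) (Icc (0 : ℝ) 1 ×ˢ S.carrier) z :=
    (S.hasFDerivWithinAt_grad hΦ hz.2).comp z hasFDerivWithinAt_snd fun z hz => hz.2
  have h2 : HasFDerivWithinAt (fun z : ℝ × E d => z.2) (ContinuousLinearMap.snd ℝ ℝ (E d))
      (Icc (0 : ℝ) 1 ×ˢ S.carrier) z := hasFDerivWithinAt_snd
  have h3 : HasFDerivWithinAt (fun z : ℝ × E d => z.1) (ContinuousLinearMap.fst ℝ ℝ (E d))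
      (Icc (0 : ℝ) 1 ×ˢ S.carrier) z := hasFDerivWithinAt_fst
  refine ((h2.add (h3.smul (h1.sub h2))).congr (fun z hz => S.grad_interp hΦ z.1 hz.2)
    (S.grad_interp hΦ z.1 hz.2)).congr_fderiv ?_
  rw [S.hess_interp hΦ z.1 hz.2]
  ext v <;> simp

/-- The inverse gradient maps along the interpolation are jointly smooth. -/
theorem contDiffOn_gradInv_interp (S : SampleSpace d) {Φ : E d → ℝ} (hΦ : Φ ∈ S.coords)
    (hI : ∀ t ∈ Icc (0 : ℝ) 1, interp Φ t ∈ S.coords) :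
    ContDiffOn ℝ ∞ (fun z : ℝ × E d => S.gradInv (interp Φ z.1) z.2)
      (Icc (0 : ℝ) 1 ×ˢ S.carrier) := by
  have hc := S.contDiffOn_of_mem_potentials hΦ.1
  obtain ⟨m, hm0, hm1, hm⟩ := S.exists_le_hess hΦ
  -- Strong monotonicity, uniform in t: the Hessian of the interpolant is bounded below by (1 - t) +
  -- tm ≥ m.
  have hlow : ∀ t ∈ Icc (0 : ℝ) 1, ∀ x ∈ S.carrier, ∀ y ∈ S.carrier,
      m * ‖x - y‖ ≤ ‖S.grad (interp Φ t) x - S.grad (interp Φ t) y‖ := by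
    intro t ht x hx y hy
    have h1 := le_inner_sub_of_fderivWithin S.convex_carrier (m := m)
      (fun x hx => S.hasFDerivWithinAt_grad (S.contDiffOn_of_mem_potentials (hI t ht).1) hx)
      (fun x hx v => ?_) hx hy
    · have h2 := h1.trans (real_inner_le_norm _ _)
      rcases (norm_nonneg (x - y)).eq_or_lt with h | h
      · rw [← h]; simp
      · refine le_of_mul_le_mul_right ?_ h
        linarith [sq ‖x - y‖]
    · rw [S.hess_interp hc t hx]
      have h3 := mul_le_mul_of_nonneg_left (hm x hx v) ht.1
      have h4 := mul_le_mul_of_nonneg_left hm1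
        (mul_nonneg (sub_nonneg.2 ht.2) (sq_nonneg ‖v‖))
      simp only [add_apply, smul_apply, sub_apply,
        ContinuousLinearMap.id_apply, inner_add_left,
        inner_smul_left, inner_sub_left, real_inner_self_eq_norm_sq, conj_trivial]
      linarith
  have hcont : ContinuousOn (fun z : ℝ × E d => S.gradInv (interp Φ z.1) z.2)
      (Icc (0 : ℝ) 1 ×ˢ S.carrier) := by
    intro z₀ hz₀
    have hx₀ := S.gradInv_mem (hI z₀.1 hz₀.1) hz₀.2
    set x₀ := S.gradInv (interp Φ z₀.1) z₀.2 with hx₀_def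
    rw [ContinuousWithinAt, tendsto_iff_norm_sub_tendsto_zero]
    -- By `hlow`, the preimage of `z.2` at time `z.1` is within m⁻¹ ‖z.2 - ∇Φ_{z.1}(x₀)‖ of `x₀`.
    -- This bound involves only the fixed point `x₀`, is continuous in `z` and vanishes at `z₀`.
    have hb : Tendsto (fun z : ℝ × E d => m⁻¹ * ‖z.2 - (x₀ + z.1 • (S.grad Φ x₀ - x₀))‖)
        (𝓝[Icc (0 : ℝ) 1 ×ˢ S.carrier] z₀) (𝓝 0) := by
      have : Continuous (fun z : ℝ × E d => m⁻¹ * ‖z.2 - (x₀ + z.1 • (S.grad Φ x₀ - x₀))‖) := by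
        fun_prop
      have h := this.continuousWithinAt (s := Icc (0 : ℝ) 1 ×ˢ S.carrier) (x := z₀)
      rwa [ContinuousWithinAt, ← S.grad_interp hc _ hx₀, hx₀_def,
        S.grad_gradInv (hI z₀.1 hz₀.1) hz₀.2, sub_self, norm_zero, mul_zero] at h
    refine squeeze_zero' (Eventually.of_forall fun _ => norm_nonneg _) ?_ hb
    filter_upwards [self_mem_nhdsWithin] with z hz
    have h := hlow z.1 hz.1 _ (S.gradInv_mem (hI z.1 hz.1) hz.2) _ hx₀
    rw [S.grad_gradInv (hI z.1 hz.1) hz.2, S.grad_interp hc _ hx₀] at h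
    rwa [le_inv_mul_iff₀ hm0]
  -- Keeping the time as a component turns joint smoothness into smoothness of one inverse map. The
  -- derivative of (t, x) ↦ (t, ∇Φ_t(x)) is block triangular with the invertible Hessian on the
  -- diagonal.
  have key := contDiffOn_of_rightInverse (s := Icc (0 : ℝ) 1 ×ˢ S.carrier)
    (t := Icc (0 : ℝ) 1 ×ˢ S.carrier)
    (f := fun z : ℝ × E d => (z.1, S.grad (interp Φ z.1) z.2))
    (g := fun z : ℝ × E d => (z.1, S.gradInv (interp Φ z.1) z.2))
    S.uniqueDiffOn_prod_carrier S.uniqueDiffOn_prod_carrier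
    (contDiffOn_fst.prodMk (S.contDiffOn_grad_interp hc))
    (fun z hz => ⟨hz.1, S.gradInv_mem (hI z.1 hz.1) hz.2⟩)
    (fun z hz => Prod.ext rfl (S.grad_gradInv (hI z.1 hz.1) hz.2))
    (continuousOn_fst.prodMk hcont) (fun z hz => ?_)
  · exact contDiff_snd.comp_contDiffOn key
  · have h1 : HasFDerivWithinAt (fun z : ℝ × E d => z.1) (ContinuousLinearMap.fst ℝ ℝ (E d))
        (Icc (0 : ℝ) 1 ×ˢ S.carrier) z := hasFDerivWithinAt_fst
    rw [(h1.prodMk (S.hasFDerivWithinAt_grad_interp hc hz)).fderivWithin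
      (S.uniqueDiffOn_prod_carrier z hz)]
    set L := (ContinuousLinearMap.fst ℝ ℝ (E d)).prod
      ((ContinuousLinearMap.fst ℝ ℝ (E d)).smulRight (S.grad Φ z.2 - z.2) +
        (S.hess (interp Φ z.1) z.2).comp (ContinuousLinearMap.snd ℝ ℝ (E d))) with hL
    have hinj : Function.Injective (L : ℝ × E d →ₗ[ℝ] ℝ × E d) := by
      rw [injective_iff_map_eq_zero]
      rintro ⟨τ, v⟩ h
      have e : L (τ, v) = (τ, τ • (S.grad Φ z.2 - z.2) + S.hess (interp Φ z.1) z.2 v) := by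
        simp [hL]
      rw [ContinuousLinearMap.coe_coe, e, Prod.mk_eq_zero] at h
      obtain ⟨rfl, h⟩ := h
      rw [zero_smul, zero_add] at h
      by_contra hne
      have hv : v ≠ 0 := fun h => hne (by simp [h])
      have := (hI z.1 hz.1).2.1 z.2 hz.2 v hv
      simp [h] at this
    refine ⟨(LinearEquiv.ofInjectiveEndo _ hinj).toContinuousLinearEquiv, ?_⟩
    ext v <;> rfl

theorem contDiffOn_push_interp (S : SampleSpace d) {Φ q : E d → ℝ} (hΦ : Φ ∈ S.coords)
    (hI : ∀ t ∈ Icc (0 : ℝ) 1, interp Φ t ∈ S.coords) (hq : ContDiffOn ℝ ∞ q S.carrier) :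
    ContDiffOn ℝ ∞ (fun z : ℝ × E d => S.push (interp Φ z.1) q z.2)
      (Icc (0 : ℝ) 1 ×ˢ S.carrier) := by
  have hc := S.contDiffOn_of_mem_potentials hΦ.1
  have hg := S.contDiffOn_gradInv_interp hΦ hI
  have hmem : ∀ z ∈ Icc (0 : ℝ) 1 ×ˢ S.carrier, S.gradInv (interp Φ z.1) z.2 ∈ S.carrier :=
    fun z hz => S.gradInv_mem (hI z.1 hz.1) hz.2
  have h1 : ContDiffOn ℝ ∞ (fun z : ℝ × E d => q (S.gradInv (interp Φ z.1) z.2))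
      (Icc (0 : ℝ) 1 ×ˢ S.carrier) := hq.comp hg hmem
  have h2 : ContDiffOn ℝ ∞
      (fun z : ℝ × E d => S.hess (interp Φ z.1) (S.gradInv (interp Φ z.1) z.2))
      (Icc (0 : ℝ) 1 ×ˢ S.carrier) :=
    (S.contDiffOn_hess_interp hc).comp (contDiffOn_fst.prodMk hg) fun z hz => ⟨hz.1, hmem z hz⟩
  refine (h1.div (contDiff_continuousLinearMap_det.comp_contDiffOn h2) fun z hz => ?_).congr
    fun z hz => S.push_of_mem _ _ hz.2
  exact (S.det_hess_pos (hI z.1 hz.1) (hmem z hz)).ne'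

theorem push_interp_mem_densities (S : SampleSpace d) {Φ q : E d → ℝ} (hΦ : Φ ∈ S.coords)
    (hI : ∀ t ∈ Icc (0 : ℝ) 1, interp Φ t ∈ S.coords) (hq : q ∈ S.densities) {t : ℝ}
    (ht : t ∈ Icc (0 : ℝ) 1) : S.push (interp Φ t) q ∈ S.densities := by
  refine ⟨⟨?_, fun v hv x => S.push_add_period (hI t ht) hq.1.2 hv x⟩,
    S.push_nonneg (hI t ht) hq.2.1, fun x hx => S.push_of_notMem _ _ hx, ?_⟩
  · exact (S.contDiffOn_push_interp hΦ hI hq.1.1).comp (f := fun x => (t, x)) (by fun_prop)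
      fun x hx => ⟨ht, hx⟩
  -- Conservation of mass is the change of variables with test function 1.
  · have := S.integral_mul_push (f := fun _ => 1) (hI t ht) hq.1.2 (fun _ _ _ => rfl)
    simp only [one_mul] at this
    rw [this, hq.2.2.2]

theorem hasDerivWithinAt_integral (S : SampleSpace d) {h : ℝ → E d → ℝ}
    (hh : ContDiffOn ℝ ∞ (fun z : ℝ × E d => h z.1 z.2) (Icc (0 : ℝ) 1 ×ˢ S.carrier)) :
    HasDerivWithinAt (fun t => S.integral (h t))
      (S.integral fun x => derivWithin (fun t => h t x) (Icc (0 : ℝ) 1) 0) (Icc (0 : ℝ) 1) 0 :=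
  hasDerivWithinAt_integral_of_contDiffOn S.uniqueDiffOn_carrier S.measurableSet_cell
    S.isCompact_closedCell S.cell_subset_closedCell S.closedCell_subset_carrier hh

theorem uniqueDiffWithinAt_zero : UniqueDiffWithinAt ℝ (Icc (0 : ℝ) 1) 0 :=
  uniqueDiffOn_Icc zero_lt_one 0 (by simp)

/-- The weak continuity equation for the displacement interpolation at its initial time. -/
theorem integral_mul_derivWithin_push_interp (S : SampleSpace d) {Φ q ξ : E d → ℝ}
    (hΦ : Φ ∈ S.coords) (hI : ∀ t ∈ Icc (0 : ℝ) 1, interp Φ t ∈ S.coords) (hq : q ∈ S.smooth)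
    (hξ : ξ ∈ S.smooth) :
    (S.integral fun x =>
      ξ x * derivWithin (fun t => S.push (interp Φ t) q x) (Icc (0 : ℝ) 1) 0) =
    S.integral fun x => inner ℝ (S.grad ξ x) (S.grad Φ x - S.grad quad x) * q x := by
  have hc := S.contDiffOn_of_mem_potentials hΦ.1
  have hp := S.contDiffOn_push_interp hΦ hI hq.1
  have h0 : (0 : ℝ) ∈ Icc (0 : ℝ) 1 := by simp
  have h1 := S.hasDerivWithinAt_integral (h := fun t x => ξ x * S.push (interp Φ t) q x)
    ((hξ.1.comp contDiffOn_snd fun z hz => hz.2).mul hp)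
  have h2 := S.hasDerivWithinAt_integral (h := fun t x => ξ (S.grad (interp Φ t) x) * q x)
    ((hξ.1.comp (S.contDiffOn_grad_interp hc) fun z hz => (hI z.1 hz.1).2.2.mapsTo hz.2).mul
      (hq.1.comp contDiffOn_snd fun z hz => hz.2))
  -- `h1` and `h2` differentiate the same function of t, by the change of variables; uniqueness of
  -- the derivative equates them.
  have h3 := h1.congr (f₁ := fun t => S.integral fun x => ξ (S.grad (interp Φ t) x) * q x)
    (fun t ht => (S.integral_mul_push (hI t ht) hq.2 hξ.2).symm)
    (S.integral_mul_push (hI 0 h0) hq.2 hξ.2).symm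
  have h4 := uniqueDiffWithinAt_zero.eq_deriv _ h3 h2
  have e1 : (S.integral fun x =>
      derivWithin (fun t => ξ x * S.push (interp Φ t) q x) (Icc (0 : ℝ) 1) 0) =
      S.integral fun x =>
        ξ x * derivWithin (fun t => S.push (interp Φ t) q x) (Icc (0 : ℝ) 1) 0 := by
    refine setIntegral_congr_fun S.measurableSet_cell fun x hx => ?_
    refine derivWithin_const_mul _ ?_
    exact (hp.differentiableOn (by simp) (0, x) ⟨h0, S.cell_subset_carrier hx⟩).comp
      (t := Icc (0 : ℝ) 1 ×ˢ S.carrier) (f := fun t : ℝ => (t, x)) 0 (by fun_prop)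
      fun t ht => ⟨ht, S.cell_subset_carrier hx⟩
  have e2 : (S.integral fun x =>
      derivWithin (fun t => ξ (S.grad (interp Φ t) x) * q x) (Icc (0 : ℝ) 1) 0) =
      S.integral fun x => inner ℝ (S.grad ξ x) (S.grad Φ x - S.grad quad x) * q x := by
    refine setIntegral_congr_fun S.measurableSet_cell fun x hx => ?_
    have hx' := S.cell_subset_carrier hx
    have hgrad : S.grad (interp Φ 0) x = x := by simp [S.grad_interp hc 0 hx']
    have hcurve : HasDerivWithinAt (fun t => S.grad (interp Φ t) x) (S.grad Φ x - x)
        (Icc (0 : ℝ) 1) 0 := by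
      have : (fun t => S.grad (interp Φ t) x) = fun t => x + t • (S.grad Φ x - x) :=
        funext fun t => S.grad_interp hc t hx'
      rw [this]
      have h := ((hasDerivAt_id (0 : ℝ)).smul_const (S.grad Φ x - x)).const_add x
      rw [one_smul] at h
      exact h.hasDerivWithinAt
    have hξd : HasFDerivWithinAt ξ (innerSL ℝ (S.grad ξ x)) S.carrier
        (S.grad (interp Φ 0) x) := by
      rw [hgrad]
      exact S.hasFDerivWithinAt_innerSL_grad (hξ.1.differentiableOn (by simp) x hx')
    have h := (hξd.comp_hasDerivWithinAt (0 : ℝ) hcurve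
      fun t ht => (hI t ht).2.2.mapsTo hx').mul_const (q x)
    refine (h.derivWithin uniqueDiffWithinAt_zero).trans ?_
    rw [S.grad_quad hx', innerSL_apply_apply]
  rw [← e1, h4, e2]

/-! ### Oscillation of transport coordinates -/

/-- The gradient inequality for the convex function `Φ`. -/
theorem inner_grad_sub_le (S : SampleSpace d) {Φ : E d → ℝ} (hΦ : Φ ∈ S.coords) {x y : E d}
    (hx : x ∈ S.carrier) (hy : y ∈ S.carrier) : inner ℝ (S.grad Φ x) (y - x) ≤ Φ y - Φ x := by
  have hc := S.contDiffOn_of_mem_potentials hΦ.1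
  let γ : ℝ → E d := fun r => x + r • (y - x)
  have hγs : MapsTo γ (Icc 0 1) S.carrier := fun r hr => S.convex_carrier.add_smul_sub_mem hx hy hr
  have hγ : ∀ r, HasDerivAt γ (y - x) r := fun r => by
    have := ((hasDerivAt_id r).smul_const (y - x)).const_add x
    rwa [one_smul] at this
  have hd : ∀ r ∈ Icc (0 : ℝ) 1, HasDerivWithinAt (fun r => Φ (γ r))
      (inner ℝ (S.grad Φ (γ r)) (y - x)) (Icc 0 1) r := fun r hr =>
    (S.hasFDerivWithinAt_innerSL_grad (hc.differentiableOn (by simp) _ (hγs hr))).comp_hasDerivWithinAt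
      r (hγ r).hasDerivWithinAt hγs
  obtain ⟨r, hr, he⟩ := exists_hasDerivAt_eq_slope (fun r => Φ (γ r))
    (fun r => inner ℝ (S.grad Φ (γ r)) (y - x)) zero_lt_one
    (fun r hr => (hd r hr).continuousWithinAt)
    (fun r hr => (hd r (Ioo_subset_Icc_self hr)).hasDerivAt (Icc_mem_nhds hr.1 hr.2))
  -- Plain monotonicity of ∇Φ: the slope at the intermediate point `γ r` is at least the slope at
  -- `x`.
  have h1 := le_inner_sub_of_fderivWithin S.convex_carrier (m := 0)
    (fun x hx => S.hasFDerivWithinAt_grad hc hx) (fun x hx v => ?_)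
    (hγs (Ioo_subset_Icc_self hr)) hx
  · have h2 : γ r - x = r • (y - x) := by simp [γ]
    rw [h2, inner_smul_right, inner_sub_left, zero_mul] at h1
    have h3 := nonneg_of_mul_nonneg_right h1 hr.1
    have h4 : γ 1 = y := by simp [γ]
    have h5 : γ 0 = x := by simp [γ]
    rw [h4, h5] at he
    linarith
  · rcases eq_or_ne v 0 with rfl | hv
    · simp
    · simpa using (hΦ.2.1 x hx v hv).le

/-- The gradient inequality between x and x ± e_i, with Φ(x ± e_i) - Φ(x) = ± x_i + 1/2 from
periodicity, bounds each coordinate of ∇Φ(x) - x by 1/2 in absolute value; the cruder bound 1 gives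
√d. -/
theorem norm_grad_sub_le_torus {Φ : E d → ℝ} (hΦ : Φ ∈ (torus : SampleSpace d).coords) (x : E d) :
    ‖torus.grad Φ x - x‖ ≤ √(d : ℝ) := by
  have key : ∀ i, ∀ s : ℝ, s = 1 ∨ s = -1 → s * (torus.grad Φ x i - x i) ≤ 1 / 2 := by
    intro i s hs
    have hv : EuclideanSpace.single i s ∈ (torus : SampleSpace d).periods := by
      intro j
      rcases hs with rfl | rfl
      · exact ⟨if j = i then 1 else 0, by simp [PiLp.single_apply]⟩
      · exact ⟨if j = i then -1 else 0, by simp [PiLp.single_apply, apply_ite]⟩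
    have h1 := inner_grad_sub_le _ hΦ (mem_univ x) (mem_univ (x + EuclideanSpace.single i s))
    have h2 := hΦ.1.2 _ hv x
    have h3 := norm_add_sq_real x (EuclideanSpace.single i s)
    have h4 : s ^ 2 = 1 := by rcases hs with rfl | rfl <;> norm_num
    simp only [add_sub_cancel_left, EuclideanSpace.inner_single_right, conj_trivial,
      PiLp.norm_single, Real.norm_eq_abs, sq_abs, h4] at h1 h3
    simp only [quad] at h2
    rw [mul_sub]
    linarith
  refine Real.le_sqrt_of_sq_le ?_
  rw [EuclideanSpace.real_norm_sq_eq]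
  refine (Finset.sum_le_sum fun i _ => ?_).trans_eq (b := ∑ _ : Fin d, (1 : ℝ)) (by simp)
  have h1 := key i 1 (Or.inl rfl)
  have h2 := key i (-1) (Or.inr rfl)
  rw [PiLp.sub_apply, sq_le_one_iff_abs_le_one, abs_le]
  constructor <;> linarith

/-- The constant does not depend on Φ because the gradient bound does not: ∇Φ maps a convex body
into itself, and on the torus ∇Φ - id is bounded by √d. This uniformity is what makes the conjugate
finite. -/
theorem exists_bound_coords (S : SampleSpace d) :
    ∃ C : ℝ, ∀ Φ ∈ S.coords, ∃ a : ℝ, ∀ x ∈ S.cell, |Φ x - a| ≤ C := by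
  obtain ⟨R, hR⟩ := S.isCompact_closedCell.isBounded.exists_norm_le
  cases S with
  | body Ω hc hv hi =>
    obtain ⟨x₀, hx₀⟩ := hi.mono interior_subset
    refine ⟨R * (R + R), fun Φ hΦ => ⟨Φ x₀, fun x hx => ?_⟩⟩
    have hd := contDiffOn_of_mem_potentials _ hΦ.1
    have h1 := hv.norm_image_sub_le_of_norm_hasFDerivWithin_le (C := R)
      (fun y hy => hasFDerivWithinAt_innerSL_grad (body Ω hc hv hi)
        (hd.differentiableOn (by simp) y hy))
      (fun y hy => by rw [innerSL_apply_norm]; exact hR _ (hΦ.2.2.mapsTo hy)) hx₀ hx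
    refine h1.trans (mul_le_mul_of_nonneg_left ?_ ((norm_nonneg _).trans (hR _ hx₀)))
    exact (norm_sub_le _ _).trans (add_le_add (hR _ hx) (hR _ hx₀))
  | torus =>
    refine ⟨√(d : ℝ) * R + R ^ 2 / 2, fun Φ hΦ => ⟨Φ 0 - quad (0 : E d), fun x hx => ?_⟩⟩
    have hd := contDiffOn_of_mem_potentials _ hΦ.1
    have h1 := convex_univ.norm_image_sub_le_of_norm_hasFDerivWithin_le (C := √(d : ℝ))
      (f := fun y => Φ y - quad y) (f' := fun y => innerSL ℝ (torus.grad Φ y - y))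
      (fun y hy => ?_) (fun y _ => by rw [innerSL_apply_norm]; exact norm_grad_sub_le_torus hΦ y)
      (mem_univ 0) (mem_univ x)
    · have hx' := hR x (cell_subset_closedCell _ hx)
      rw [sub_zero] at h1
      have h2 : |quad x| ≤ R ^ 2 / 2 := by
        rw [quad, abs_of_nonneg (by positivity)]
        have := pow_le_pow_left₀ (norm_nonneg x) hx' 2
        linarith
      have h3 := h1.trans (mul_le_mul_of_nonneg_left hx' (Real.sqrt_nonneg _))
      rw [Real.norm_eq_abs] at h3
      calc |Φ x - (Φ 0 - quad 0)| = |(Φ x - quad x - (Φ 0 - quad 0)) + quad x| := by ring_nf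
        _ ≤ _ := (abs_add_le _ _).trans (add_le_add h3 h2)
    · rw [map_sub]
      exact (hasFDerivWithinAt_innerSL_grad (torus : SampleSpace d)
        (hd.differentiableOn (by simp) y (mem_univ y))).sub (hasFDerivAt_quad y).hasFDerivWithinAt

/-! ### Legendre duality -/

theorem le_of_hasDerivWithinAt_zero {f : ℝ → ℝ} {D M : ℝ}
    (hd : HasDerivWithinAt f D (Icc (0 : ℝ) 1) 0)
    (h : ∀ t ∈ Icc (0 : ℝ) 1, f t - f 0 ≤ t * M) : D ≤ M := by
  rw [hasDerivWithinAt_iff_tendsto_slope, Icc_sdiff_left] at hd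
  have : (𝓝[Ioc (0 : ℝ) 1] 0).NeBot := left_nhdsWithin_Ioc_neBot zero_lt_one
  refine le_of_tendsto hd ?_
  filter_upwards [self_mem_nhdsWithin] with t ht
  rw [slope_def_field, sub_zero, div_le_iff₀ ht.1, mul_comm]
  exact h t (Ioc_subset_Icc_self ht)

theorem derivWithin_add_mul (a b : ℝ) :
    derivWithin (fun t : ℝ => a + t * b) (Icc (0 : ℝ) 1) 0 = b := by
  have h := ((hasDerivAt_id (0 : ℝ)).mul_const b).const_add a
  rw [one_mul] at h
  exact h.hasDerivWithinAt.derivWithin uniqueDiffWithinAt_zero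

theorem integral_sub (S : SampleSpace d) {f g : E d → ℝ} (hf : ContinuousOn f S.carrier)
    (hg : ContinuousOn g S.carrier) :
    (S.integral fun x => f x - g x) = S.integral f - S.integral g :=
  MeasureTheory.integral_sub (S.integrableOn_cell hf) (S.integrableOn_cell hg)

theorem integral_add (S : SampleSpace d) {f g : E d → ℝ} (hf : ContinuousOn f S.carrier)
    (hg : ContinuousOn g S.carrier) :
    (S.integral fun x => f x + g x) = S.integral f + S.integral g :=
  MeasureTheory.integral_add (S.integrableOn_cell hf) (S.integrableOn_cell hg)

theorem integral_const_mul (S : SampleSpace d) (c : ℝ) (f : E d → ℝ) :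
    (S.integral fun x => c * f x) = c * S.integral f :=
  MeasureTheory.integral_const_mul c f

theorem continuousOn_of_mem_smooth (S : SampleSpace d) {f : E d → ℝ} (hf : f ∈ S.smooth) :
    ContinuousOn f S.carrier := hf.1.continuousOn

theorem continuousOn_of_mem_coords (S : SampleSpace d) {f : E d → ℝ} (hf : f ∈ S.coords) :
    ContinuousOn f S.carrier := (S.contDiffOn_of_mem_potentials hf.1).continuousOn

theorem add_const_mul_mem_duals (S : SampleSpace d) {f g : E d → ℝ} (hf : f ∈ S.duals)
    (hg : g ∈ S.duals) (c : ℝ) : (fun x => f x + c * g x) ∈ S.duals := by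
  refine ⟨⟨hf.1.1.add (contDiffOn_const.mul hg.1.1), fun v hv x => ?_⟩, ?_⟩
  · dsimp only
    rw [hf.1.2 v hv, hg.1.2 v hv]
  · rw [S.integral_add (S.continuousOn_of_mem_smooth hf.1)
      (continuousOn_const.fun_mul (S.continuousOn_of_mem_smooth hg.1)), S.integral_const_mul, hf.2, hg.2]
    simp

/-- The derivative of a functional along an affine curve. -/
theorem IsFirstVariation.hasDerivWithinAt_affine {S : SampleSpace d} {dom : Set (E d → ℝ)}
    {G : (E d → ℝ) → ℝ} {f g h : E d → ℝ} (hG : S.IsFirstVariation dom G f g)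
    (hf : ContDiffOn ℝ ∞ f S.carrier) (hh : ContDiffOn ℝ ∞ h S.carrier)
    (hdom : ∀ t ∈ Icc (0 : ℝ) 1, (fun x => f x + t * h x) ∈ dom) :
    HasDerivWithinAt (fun t => G (fun x => f x + t * h x)) (S.integral fun x => g x * h x)
      (Icc (0 : ℝ) 1) 0 := by
  have h1 := hG.2 (fun t x => f x + t * h x) ?_ hdom (by simp)
  · simpa only [derivWithin_add_mul] using h1
  · exact (hf.comp contDiffOn_snd fun z hz => hz.2).add
      (contDiffOn_fst.mul (hh.comp contDiffOn_snd fun z hz => hz.2))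

section Conjugate

variable {S : SampleSpace d} {K : Set (E d → ℝ)} {G : (E d → ℝ) → ℝ} {Φ Φs : E d → ℝ}

/-- A first variation of a convex functional is a subgradient. -/
theorem IsFirstVariation.integral_mul_sub_le (hK : K ⊆ S.coords) (hG : ConvexOn ℝ K G)
    (h : S.IsFirstVariation K G Φ Φs) {Φ' : E d → ℝ} (hΦ' : Φ' ∈ K) :
    (S.integral fun x => Φs x * (Φ' x - Φ x)) ≤ G Φ' - G Φ := by
  have e : ∀ t : ℝ, (fun x => Φ x + t * (Φ' x - Φ x)) = (1 - t) • Φ + t • Φ' := by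
    intro t; funext x; simp; ring
  have hd := h.hasDerivWithinAt_affine (h := fun x => Φ' x - Φ x)
    (S.contDiffOn_of_mem_potentials (hK h.1).1)
    ((S.contDiffOn_of_mem_potentials (hK hΦ').1).sub
      (S.contDiffOn_of_mem_potentials (hK h.1).1)) fun t ht => by
        rw [e]; exact hG.1 h.1 hΦ' (sub_nonneg.2 ht.2) ht.1 (by ring)
  refine le_of_hasDerivWithinAt_zero hd fun t ht => ?_
  have h1 := hG.2 h.1 hΦ' (sub_nonneg.2 ht.2) ht.1 (by ring)
  simp only [e, smul_eq_mul, sub_zero, one_smul, zero_smul, add_zero] at h1 ⊢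
  linarith

/-- The derivative along Φ + t is ∫Φ*, and `G` is constant on that curve. -/
theorem IsFirstVariation.mem_duals (hK : K ⊆ S.coords)
    (hconst : ∀ Φ ∈ K, ∀ a : ℝ, (fun x => Φ x + a) ∈ K)
    (hinv : ∀ Φ : E d → ℝ, ∀ a : ℝ, G (fun x => Φ x + a) = G Φ) (hs : Φs ∈ S.smooth)
    (h : S.IsFirstVariation K G Φ Φs) : Φs ∈ S.duals := by
  refine ⟨hs, ?_⟩
  have hd := h.hasDerivWithinAt_affine (h := fun _ => 1)
    (S.contDiffOn_of_mem_potentials (hK h.1).1) contDiffOn_const fun t _ => hconst Φ h.1 _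
  simp only [mul_one, hinv] at hd
  exact uniqueDiffWithinAt_zero.eq_deriv _ hd (hasDerivWithinAt_const _ _ _)

/-- The subgradient inequality bounds the values at `Φs`. Passing to `y` adds ∫Φ'(y - Φ*); as y - Φ*
has mean zero, Φ' may be replaced by Φ' - a, which is bounded by the uniform oscillation constant.
-/
theorem bddAbove_conjValues (hK : K ⊆ S.coords) (hG : ConvexOn ℝ K G) (hs : Φs ∈ S.duals)
    (h : S.IsFirstVariation K G Φ Φs) {y : E d → ℝ} (hy : y ∈ S.duals) :
    BddAbove (S.conjValues K G y) := by
  obtain ⟨C, hC⟩ := S.exists_bound_coords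
  refine ⟨(C * S.integral fun x => |y x - Φs x|) + (S.integral fun x => Φs x * Φ x) - G Φ, ?_⟩
  rintro r ⟨Φ', hΦ', rfl⟩
  obtain ⟨a, ha⟩ := hC Φ' (hK hΦ')
  have h1 := h.integral_mul_sub_le hK hG hΦ'
  have c1 := S.continuousOn_of_mem_coords (hK h.1)
  have c2 := S.continuousOn_of_mem_coords (hK hΦ')
  have c3 := S.continuousOn_of_mem_smooth hs.1
  have c4 := S.continuousOn_of_mem_smooth hy.1
  have e1 : (S.integral fun x => Φs x * (Φ' x - Φ x)) =
      (S.integral fun x => Φs x * Φ' x) - S.integral fun x => Φs x * Φ x := by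
    rw [← S.integral_sub (c3.fun_mul c2) (c3.fun_mul c1)]
    simp only [mul_sub]
  have e2 : (S.integral fun x => (Φ' x - a) * (y x - Φs x)) =
      (S.integral fun x => Φ' x * y x) - S.integral fun x => Φs x * Φ' x := by
    have : (fun x => (Φ' x - a) * (y x - Φs x)) =
        fun x => (Φ' x * y x - Φs x * Φ' x) - (a * y x - a * Φs x) := by funext x; ring
    rw [this, S.integral_sub ((c2.fun_mul c4).fun_sub (c3.fun_mul c2))
      ((continuousOn_const.fun_mul c4).fun_sub (continuousOn_const.fun_mul c3)),
      S.integral_sub (c2.fun_mul c4) (c3.fun_mul c2),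
      S.integral_sub (continuousOn_const.fun_mul c4) (continuousOn_const.fun_mul c3),
      S.integral_const_mul, S.integral_const_mul, hs.2, hy.2]
    ring
  have h2 : (S.integral fun x => (Φ' x - a) * (y x - Φs x)) ≤
      C * S.integral fun x => |y x - Φs x| := by
    rw [← S.integral_const_mul]
    refine setIntegral_mono_on (S.integrableOn_cell ((c2.fun_sub continuousOn_const).mul (c4.fun_sub c3)))
      (S.integrableOn_cell (continuousOn_const.fun_mul (c4.fun_sub c3).abs)) S.measurableSet_cell
      fun x hx => ?_
    refine (le_abs_self _).trans ?_
    rw [abs_mul]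
    exact mul_le_mul_of_nonneg_right (ha x hx) (abs_nonneg _)
  linarith

/-- Equality in the Fenchel inequality at a first variation. -/
theorem conj_eq (hK : K ⊆ S.coords) (hG : ConvexOn ℝ K G) (hs : Φs ∈ S.smooth)
    (h : S.IsFirstVariation K G Φ Φs) :
    S.conj K G Φs = (S.integral fun x => Φ x * Φs x) - G Φ := by
  refine IsGreatest.csSup_eq ⟨⟨Φ, h.1, rfl⟩, ?_⟩
  rintro r ⟨Φ', hΦ', rfl⟩
  have h1 := h.integral_mul_sub_le hK hG hΦ'
  have c1 := S.continuousOn_of_mem_coords (hK h.1)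
  have c2 := S.continuousOn_of_mem_coords (hK hΦ')
  have c3 := S.continuousOn_of_mem_smooth hs
  have e1 : (S.integral fun x => Φs x * (Φ' x - Φ x)) =
      (S.integral fun x => Φ' x * Φs x) - S.integral fun x => Φ x * Φs x := by
    rw [← S.integral_sub (c2.fun_mul c3) (c1.fun_mul c3)]
    congr 1; funext x; ring
  linarith

/-- The first variation of the conjugate at `Φs` acts on dual variables as `Φ` does. -/
theorem integral_mul_eq_of_isFirstVariation_conj (hK : K ⊆ S.coords) (hG : ConvexOn ℝ K G)
    (hs : Φs ∈ S.duals) (h : S.IsFirstVariation K G Φ Φs) {Ψ : E d → ℝ}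
    (hconj : S.IsFirstVariation S.duals (S.conj K G) Φs Ψ) {η : E d → ℝ} (hη : η ∈ S.duals) :
    (S.integral fun x => Ψ x * η x) = S.integral fun x => Φ x * η x := by
  -- Φ is a competitor in the supremum at Φ* + tη and is optimal at t = 0, which gives one
  -- inequality between the slopes; replacing η by -η gives the other.
  have key : ∀ η ∈ S.duals,
      (S.integral fun x => Φ x * η x) ≤ S.integral fun x => Ψ x * η x := by
    intro η hη
    have hd := hconj.hasDerivWithinAt_affine hs.1.1 hη.1.1
      fun t _ => S.add_const_mul_mem_duals hs hη t
    refine neg_le_neg_iff.1 (le_of_hasDerivWithinAt_zero hd.neg fun t _ => ?_)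
    have h1 : (S.integral fun x => Φ x * (Φs x + t * η x)) - G Φ ≤
        S.conj K G (fun x => Φs x + t * η x) :=
      le_csSup (bddAbove_conjValues hK hG hs h (S.add_const_mul_mem_duals hs hη t)) ⟨Φ, h.1, rfl⟩
    have h2 := conj_eq hK hG hs.1 h
    have c1 := S.continuousOn_of_mem_coords (hK h.1)
    have e : (S.integral fun x => Φ x * (Φs x + t * η x)) =
        (S.integral fun x => Φ x * Φs x) + t * S.integral fun x => Φ x * η x := by
      have : (fun x => Φ x * (Φs x + t * η x)) = fun x => Φ x * Φs x + t * (Φ x * η x) := by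
        funext x; ring
      rw [this, S.integral_add (c1.fun_mul (S.continuousOn_of_mem_smooth hs.1))
        (continuousOn_const.fun_mul (c1.fun_mul (S.continuousOn_of_mem_smooth hη.1))),
        S.integral_const_mul]
    simp only [zero_mul, add_zero, Pi.neg_apply]
    linarith
  refine le_antisymm ?_ (key η hη)
  have hneg : (fun x => -η x) ∈ S.duals := by
    refine ⟨⟨hη.1.1.neg, fun v hv x => by simp only [hη.1.2 v hv x]⟩, ?_⟩
    simpa [integral, MeasureTheory.integral_neg] using hη.2
  have := key _ hneg
  simpa [integral, MeasureTheory.integral_neg] using this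

/-- A function that is orthogonal to the dual variables is constant. -/
theorem exists_eqOn_const_of_integral_mul_eq_zero {u : E d → ℝ} (hu : u ∈ S.smooth)
    (h : ∀ η ∈ S.duals, (S.integral fun x => u x * η x) = 0) :
    ∃ a : ℝ, ∀ x ∈ S.carrier, u x = a := by
  have hvol : (volume S.cell).toReal ≠ 0 :=
    ENNReal.toReal_ne_zero.2 ⟨S.volume_cell_ne_zero,
      (lt_of_le_of_lt (measure_mono S.cell_subset_closedCell)
        S.isCompact_closedCell.measure_lt_top).ne⟩
  have hconst : ∀ c : ℝ, (S.integral fun _ => c) = (volume S.cell).toReal * c := by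
    intro c; simp [integral, Measure.real]
  -- With `a` the mean of `u`, the function u - a is itself an admissible test function, so ∫(u -
  -- a)² = 0.
  set a := S.integral u / (volume S.cell).toReal with ha
  have hc := S.continuousOn_of_mem_smooth hu
  have hη : (fun x => u x - a) ∈ S.duals := by
    refine ⟨⟨hu.1.sub contDiffOn_const, fun v hv x => by simp only [hu.2 v hv x]⟩, ?_⟩
    rw [S.integral_sub hc continuousOn_const, hconst, ha, mul_div_cancel₀ _ hvol, sub_self]
  have hcη : ContinuousOn (fun x => u x - a) S.carrier := hc.fun_sub continuousOn_const
  have h0 : (S.integral fun x => (u x - a) * (u x - a)) = 0 := by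
    have e : (fun x => (u x - a) * (u x - a)) = fun x => u x * (u x - a) - a * (u x - a) := by
      funext x; ring
    rw [e, S.integral_sub (hc.fun_mul hcη) (continuousOn_const.fun_mul hcη), h _ hη,
      S.integral_const_mul, hη.2]
    simp
  have hae := (setIntegral_eq_zero_iff_of_nonneg_ae
    (Eventually.of_forall fun x => mul_self_nonneg _) (S.integrableOn_cell (hcη.mul hcη))).1 h0
  have := S.eqOn_carrier_of_ae_cell hη.1 (hae.mono fun x hx => mul_self_eq_zero.1 hx)
  exact ⟨a, fun x hx => sub_eq_zero.1 (this hx)⟩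

/-- Mean-zero variations see Ψ only up to a constant, so only gradients can agree. On the torus
neither Ψ nor Φ is periodic, but their difference is. -/
theorem grad_eq_of_isFirstVariation_conj (hK : K ⊆ S.coords) (hG : ConvexOn ℝ K G)
    (hs : Φs ∈ S.duals) (h : S.IsFirstVariation K G Φ Φs) {Ψ : E d → ℝ} (hΨ : Ψ ∈ S.potentials)
    (hconj : S.IsFirstVariation S.duals (S.conj K G) Φs Ψ) {x : E d} (hx : x ∈ S.carrier) :
    S.grad Ψ x = S.grad Φ x := by
  have c1 := S.continuousOn_of_mem_coords (hK h.1)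
  have c2 := (S.contDiffOn_of_mem_potentials hΨ).continuousOn
  obtain ⟨a, ha⟩ := exists_eqOn_const_of_integral_mul_eq_zero
    (S.sub_mem_smooth hΨ (hK h.1).1) fun η hη => by
      have c3 := S.continuousOn_of_mem_smooth hη.1
      simp only [sub_mul]
      rw [S.integral_sub (c2.fun_mul c3) (c1.fun_mul c3),
        integral_mul_eq_of_isFirstVariation_conj hK hG hs h hconj hη, sub_self]
  rw [← S.grad_add_const Φ a]
  have heq : EqOn Ψ (fun x => Φ x + a) S.carrier := fun x hx => by
    have := ha x hx
    dsimp only at this ⊢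
    linarith
  rw [grad, grad, gradientWithin, gradientWithin, fderivWithin_congr heq (heq hx)]

/-- Legendre conjugation exchanges the arguments of the Bregman divergence. -/
theorem bregman_conj (hK : K ⊆ S.coords) (hG : ConvexOn ℝ K G) {Φ₁ Φ₂ η₁ η₂ Ψ : E d → ℝ}
    (hη₁ : η₁ ∈ S.duals) (hη₂ : η₂ ∈ S.duals) (h₁ : S.IsFirstVariation K G Φ₁ η₁)
    (h₂ : S.IsFirstVariation K G Φ₂ η₂)
    (hconj : S.IsFirstVariation S.duals (S.conj K G) η₁ Ψ) :
    S.bregman G Φ₁ Φ₂ η₂ = S.bregman (S.conj K G) η₂ η₁ Ψ := by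
  have c1 := S.continuousOn_of_mem_coords (hK h₁.1)
  have c2 := S.continuousOn_of_mem_coords (hK h₂.1)
  have d1 := S.continuousOn_of_mem_smooth hη₁.1
  have d2 := S.continuousOn_of_mem_smooth hη₂.1
  -- The difference η₂ - η₁ has mean zero, so Ψ can be exchanged for Φ₁ in its pairing; the rest is
  -- the equality case of Fenchel's inequality at both points.
  have hmem := S.add_const_mul_mem_duals hη₂ hη₁ (-1)
  have e := integral_mul_eq_of_isFirstVariation_conj hK hG hη₁ h₁ hconj hmem
  have e1 : (S.integral fun x => (η₂ x - η₁ x) * Ψ x) =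
      (S.integral fun x => Φ₁ x * η₂ x) - S.integral fun x => Φ₁ x * η₁ x := by
    rw [← S.integral_sub (c1.fun_mul d2) (c1.fun_mul d1)]
    convert e using 2 <;> funext x <;> ring
  have e2 : (S.integral fun x => (Φ₁ x - Φ₂ x) * η₂ x) =
      (S.integral fun x => Φ₁ x * η₂ x) - S.integral fun x => Φ₂ x * η₂ x := by
    rw [← S.integral_sub (c1.fun_mul d2) (c2.fun_mul d2)]
    simp only [sub_mul]
  rw [bregman, bregman, conj_eq hK hG hη₁.1 h₁, conj_eq hK hG hη₂.1 h₂, e1, e2]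
  ring

end Conjugate

/-! ### Transport divergence and the main theorem -/

/-- The transport Bregman divergence is the Bregman divergence in transport coordinates. -/
theorem transportBregman_eq_bregman {S : SampleSpace d} {F : (E d → ℝ) → ℝ}
    {q : E d → ℝ} (hq : q ∈ S.densities) {K : Set (E d → ℝ)} (hK : K ⊆ S.coords)
    (hconv : ConvexOn ℝ K (S.lift F q)) {p Φp ξ Φqs : E d → ℝ} (hp : p ∈ S.densities)
    (hΦp : Φp ∈ K) (hpush : S.IsPush Φp q p) (hξ : ξ ∈ S.smooth)
    (hF : S.IsFirstVariation S.densities F q ξ)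
    (hΦqs : S.IsFirstVariation K (S.lift F q) quad Φqs) :
    S.transportBregman F p q Φp ξ = S.bregman (S.lift F q) Φp quad Φqs := by
  have hcoord := hK hΦp
  have hquad := hK hΦqs.1
  have hIK : ∀ t ∈ Icc (0 : ℝ) 1, interp Φp t ∈ K := fun t ht =>
    hconv.1 hΦqs.1 hΦp (sub_nonneg.2 ht.2) ht.1 (by ring)
  have hI : ∀ t ∈ Icc (0 : ℝ) 1, interp Φp t ∈ S.coords := fun t ht => hK (hIK t ht)
  have hzero : interp Φp 0 = quad := by simp [interp]
  have hpushq : S.push quad q = q := S.push_quad hquad hq.2.2.1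
  have h1 := hF.2 (fun t => S.push (interp Φp t) q) (S.contDiffOn_push_interp hcoord hI hq.1.1)
    (fun t ht => S.push_interp_mem_densities hcoord hI hq ht) (by rw [hzero, hpushq])
  have h2 := hΦqs.2 (interp Φp)
    (S.contDiffOn_interp (S.contDiffOn_of_mem_potentials hcoord.1)) hIK hzero
  -- By definition of `lift`, both statements differentiate the same function t ↦ F(p_t), once
  -- through densities and once through potentials.
  have h3 := uniqueDiffWithinAt_zero.eq_deriv _ h1 h2
  have e : ∀ x, derivWithin (fun t => interp Φp t x) (Icc (0 : ℝ) 1) 0 = Φp x - quad x := by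
    intro x
    rw [← derivWithin_add_mul (quad x) (Φp x - quad x)]
    congr 1; funext t; simp [interp]; ring
  rw [S.integral_mul_derivWithin_push_interp hcoord hI hq.1 hξ] at h3
  rw [transportBregman, bregman, h3, lift, lift, S.push_eq_of_isPush hcoord hp.2.2.1 hpush, hpushq]
  simp only [e, mul_comm]

end SampleSpace

theorem mainTheorem2 {d : ℕ} (S : SampleSpace d) (F : (E d → ℝ) → ℝ)
    (q : E d → ℝ) (hq : q ∈ S.densities)
    (K : Set (E d → ℝ)) (hK : K ⊆ S.coords)
    (hKconst : ∀ Φ ∈ K, ∀ a : ℝ, (fun x => Φ x + a) ∈ K)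
    (hconv : ConvexOn ℝ K (S.lift F q)) :
    -- the conjugate is finite on the dual variables
    (∀ Φ Φs : E d → ℝ, Φs ∈ S.smooth →
      S.IsFirstVariation K (S.lift F q) Φ Φs →
      Φs ∈ S.duals ∧ ∀ y ∈ S.duals, BddAbove (S.conjValues K (S.lift F q) y)) ∧
    -- (i)
    (∀ Φ Φs Ψ : E d → ℝ, Φs ∈ S.smooth → Ψ ∈ S.potentials →
      S.IsFirstVariation K (S.lift F q) Φ Φs →
      S.IsFirstVariation S.duals (S.conj K (S.lift F q)) Φs Ψ →
      ∀ x ∈ S.carrier, S.grad Ψ x = S.grad Φ x) ∧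
    -- (ii)
    (∀ p Φp ξ Φqs : E d → ℝ,
      p ∈ S.densities → Φp ∈ K → S.IsPush Φp q p →
      ξ ∈ S.smooth → S.IsFirstVariation S.densities F q ξ →
      Φqs ∈ S.smooth →
      S.IsFirstVariation K (S.lift F q) SampleSpace.quad Φqs →
      S.transportBregman F p q Φp ξ =
        S.bregman (S.lift F q) Φp SampleSpace.quad Φqs) ∧
    -- (iii)
    (∀ p Φp ξ Φqs Φps Ψp : E d → ℝ,
      p ∈ S.densities → Φp ∈ K → S.IsPush Φp q p →
      ξ ∈ S.smooth → S.IsFirstVariation S.densities F q ξ →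
      Φqs ∈ S.smooth →
      S.IsFirstVariation K (S.lift F q) SampleSpace.quad Φqs →
      Φps ∈ S.smooth →
      S.IsFirstVariation K (S.lift F q) Φp Φps →
      Ψp ∈ S.potentials →
      S.IsFirstVariation S.duals (S.conj K (S.lift F q)) Φps Ψp →
      S.bregman (S.lift F q) Φp SampleSpace.quad Φqs =
        S.bregman (S.conj K (S.lift F q)) Φqs Φps Ψp ∧
      S.bregman (S.conj K (S.lift F q)) Φqs Φps Ψp =
        S.transportBregman F p q Φp ξ) := by
  -- The push-forward depends on Φ only through ∇Φ.
  have hinv : ∀ (Φ : E d → ℝ) (a : ℝ), S.lift F q (fun x => Φ x + a) = S.lift F q Φ :=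
    fun Φ a => by rw [SampleSpace.lift, S.push_add_const, SampleSpace.lift]
  have hdual : ∀ Φ Φs : E d → ℝ, Φs ∈ S.smooth → S.IsFirstVariation K (S.lift F q) Φ Φs →
      Φs ∈ S.duals := fun Φ Φs hs h => h.mem_duals hK hKconst hinv hs
  refine ⟨fun Φ Φs hs h => ⟨hdual Φ Φs hs h, fun y hy =>
      SampleSpace.bddAbove_conjValues hK hconv (hdual Φ Φs hs h) h hy⟩,
    fun Φ Φs Ψ hs hΨ h hconj x hx =>
      SampleSpace.grad_eq_of_isFirstVariation_conj hK hconv (hdual Φ Φs hs h) h hΨ hconj hx,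
    fun p Φp ξ Φqs hp hΦp hpush hξ hF _ h =>
      SampleSpace.transportBregman_eq_bregman hq hK hconv hp hΦp hpush hξ hF h,
    fun p Φp ξ Φqs Φps Ψp hp hΦp hpush hξ hF hqs h hps h' _ hconj => ?_⟩
  have h1 := SampleSpace.bregman_conj hK hconv (hdual _ _ hps h') (hdual _ _ hqs h) h' h hconj
  exact ⟨h1, h1.symm.trans
    (SampleSpace.transportBregman_eq_bregman hq hK hconv hp hΦp hpush hξ hF h).symm⟩
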